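/- Call a partial order $(P,\le)$ a poset tree if it has a greatest element (the root) and, for every $x\in P$, the set $P_{\ge x}=\{y\in P: y\ge x\}$ is a finite linear order. A child of $x\in P$ is an element $y<x$ such that no $z\in P$ satisfies $y<z<x$; a branching node is an element with at least two children. A poset tree is binary if every element has at most two children, and uniquely branching if for every $n\in\mathbb N$ there is at most one branching node $x$ with $|P_{\ge x}|=n$. An infinite structure $(D,R)$ with one binary relation is computable if $D$ is a computable subset of $\mathbb N$ and $R$ is computable, and it is punctually presentable if it is isomorphic to a structure $(\mathbb N,S)$ with $S$ primitive recursive. A class of such structures is punctually robust if every infinite computable member of it is punctually presentable. Theorem. The class of poset trees is not punctually robust. In fact, there is a computable binary relation $\le_T$ on $\mathbb N$ such that $(\mathbb N,\le_T)$ is a uniquely branching binary poset tree that is not isomorphic to any poset tree $(\mathbb N,\le')$ with $\le'$ primitive recursive. -/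

import Mathlib

/-- The order `le` on `P` is a poset tree: a partial order with a greatest element (the root)
such that for every `x` the set of all `y` with `le x y` is a finite linear order. -/
def IsPosetTree {P : Type} (le : P → P → Prop) : Prop :=
  (∀ x, le x x) ∧
  (∀ x y, le x y → le y x → x = y) ∧
  (∀ x y z, le x y → le y z → le x z) ∧
  (∃ r, ∀ x, le x r) ∧
  ∀ x, {y | le x y}.Finite ∧ ∀ y z, le x y → le x z → le y z ∨ le z y

/-- `y` is a child of `x`: `y` lies strictly below `x` and nothing lies strictly between. -/
def IsChildOf {P : Type} (le : P → P → Prop) (y x : P) : Prop :=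
  le y x ∧ y ≠ x ∧ ¬ ∃ z, (le y z ∧ y ≠ z) ∧ (le z x ∧ z ≠ x)

/-- `x` is a branching node: it has at least two children. -/
def IsBranchingNode {P : Type} (le : P → P → Prop) (x : P) : Prop :=
  ∃ y z, y ≠ z ∧ IsChildOf le y x ∧ IsChildOf le z x

/-- For every `n` there is at most one branching node `x` with exactly `n` elements above
or equal to it. -/
def IsUniquelyBranching {P : Type} (le : P → P → Prop) : Prop :=
  ∀ n : ℕ, ∀ x y, IsBranchingNode le x → IsBranchingNode le y →
    {z | le x z}.encard = n → {z | le y z}.encard = n → x = y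

/-- Every node has at most two children. -/
def IsBinaryTree {P : Type} (le : P → P → Prop) : Prop :=
  ∀ x, {y | IsChildOf le y x}.encard ≤ 2

/-- The (infinite) structure with one binary relation `r` on the domain `D ⊆ ℕ` is computable:
its domain is a computable set and its relation is a computable set of pairs. -/
def IsComputableStructure (D : Set ℕ) (r : D → D → Prop) : Prop :=
  D.Infinite ∧
  ComputablePred (fun x : ℕ => x ∈ D) ∧
  ComputablePred (fun p : ℕ × ℕ => ∃ (h₁ : p.1 ∈ D) (h₂ : p.2 ∈ D), r ⟨p.1, h₁⟩ ⟨p.2, h₂⟩)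

/-- The structure `(P, r)` is punctually presentable: it is isomorphic to a structure with
domain `ℕ` whose relation is primitive recursive. -/
def IsPunctuallyPresentable {P : Type} (r : P → P → Prop) : Prop :=
  ∃ s : ℕ → ℕ → Prop, PrimrecRel s ∧ Nonempty (r ≃r s)

/-- A class `K` of structures with one binary relation is punctually robust: every (infinite)
computable member is punctually presentable. -/
def PunctuallyRobust (K : ∀ P : Type, (P → P → Prop) → Prop) : Prop :=
  ∀ (D : Set ℕ) (r : D → D → Prop), IsComputableStructure D r → K D r →
    IsPunctuallyPresentable r

/-! Fix a computable sequence of relations that contains all primitive recursive ones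
(`exists_universal`). A computable tree is built in finite steps so that, for every b, it is not
isomorphic to the relation S with index b if S is a poset tree.

One requirement. The tree grows at one leaf by modules (`IsBlock`): a stem that ends in a leaf and a
fork; below the fork hang a tooth, whose length is the width of the module, and a longer branch, at
the end of which the tree grows on. Since S is total, one can wait until its elements 0, ..., n,
with n the size of the tree, look right: some g embeds the tree up to the top of the longer branch,
and all other elements up to n lie below the image of that top (`IsCommitment`). Then the module is
abandoned and the tree grows on below its leaf. S has shown n + 1 elements and the tree has n, so
there are more elements below the image of the fork than there will ever be below the fork. Hence in
a later commitment that image lies below the image of the leaf (`IsCommitment.fork_le_leaf`). A new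
module for b is built there. The images of the old tooth and of the old longer branch are
incomparable, and at least as many elements as the old width lie below each. The side branches built
on the way to the new fork are smaller, and the path to the new fork is a chain. So both images land
below the new fork, under its tooth or its longer branch (`IsCommitment.descend`). If this recurs
for ever, some element of S has arbitrarily many elements above it, and S is no poset tree.

All requirements. The modules form a stack, each built below the one before. A suffix of the stack
is cut off only if all its records commit. The records are then built again in the same order, each
with the era of the next one. So the era of a requirement grows, and the modules rebuilt in front of
it are narrower (`reassign_split`), as the descent demands. If the first era permits, a larger
requirement is put in front. Equal requirements on the stack are separated by smaller ones, so fewer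
than 2 ^ b entries have a requirement below b (`count_lt_le`). Hence there is a maximal permanent
part that is empty or ends with such an entry (`exists_settled`), and requirement b at some time
comes right after it (`IsSettled.exists_eq`). Were its module permanent and S isomorphic to the
tree, the module would commit from some stage on (`IsPermanent.eventually_commits`) and a permanent
smaller requirement would follow it (`IsPermanent.extend`), against maximality. So it is cut off and
rebuilt for ever (`not_iso`).

A stem is as long as the whole tree before it, which separates the levels of the branching nodes. A
step uses finitely many values of the sequence, so the tree is computable. -/

namespace PosetTreeConstruction

/-! ### Stacks, their records, and cuts -/

/-- A module on the stack: its requirement, its era, and the size of the tree when it was built. -/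
abbrev Entry := ℕ × ℕ × ℕ

/-- The entries whose requirement is smaller than all requirements before them. -/
def records (l : List Entry) : List Entry :=
  l.foldr (fun c acc => c :: acc.filter fun x => x.1 < c.1) []

@[simp] lemma records_cons (c : Entry) (t : List Entry) :
    records (c :: t) = c :: (records t).filter fun x => x.1 < c.1 := rfl

lemma records_sublist : ∀ l, (records l).Sublist l
  | [] => .slnil
  | c :: t => by
    rw [records_cons]
    exact ((List.filter_sublist).trans (records_sublist t)).cons_cons c

lemma records_sorted : ∀ l, (records l).Pairwise fun x y => y.1 < x.1
  | [] => .nil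
  | c :: t => by
    rw [records_cons, List.pairwise_cons]
    refine ⟨fun x hx => ?_, (records_sorted t).filter _⟩
    simpa using (List.mem_filter.1 hx).2

lemma mem_records {x : Entry} : ∀ {l : List Entry},
    x ∈ records l ↔ ∃ A B, l = A ++ x :: B ∧ ∀ y ∈ A, x.1 < y.1
  | [] => by simp [records]
  | c :: t => by
    rw [records_cons, List.mem_cons, List.mem_filter, mem_records (l := t)]
    constructor
    · rintro (rfl | ⟨⟨A, B, rfl, h⟩, hx⟩)
      · exact ⟨[], t, rfl, by simp⟩
      · refine ⟨c :: A, B, rfl, ?_⟩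
        rintro y (_ | ⟨_, hy⟩)
        · simpa using hx
        · exact h y hy
    · rintro ⟨_ | ⟨a, A⟩, B, h, hA⟩
      · simp only [List.nil_append, List.cons.injEq] at h
        exact .inl h.1.symm
      · simp only [List.cons_append, List.cons.injEq] at h
        obtain ⟨rfl, rfl⟩ := h
        exact .inr ⟨⟨A, B, rfl, fun y hy => hA y (List.mem_cons_of_mem _ hy)⟩,
          by simpa using hA c List.mem_cons_self⟩

variable (ok : Entry → Bool)

/-- Cut the stack before the first suffix all of whose records are `ok`; return the part kept and
the records of the part removed. -/
def cut : List Entry → List Entry × List Entry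
  | [] => ([], [])
  | c :: t => if (records (c :: t)).all ok then ([], records (c :: t))
    else (c :: (cut t).1, (cut t).2)

/-- Either nothing is cut, or the stack is cut before a suffix with `ok` records. -/
lemma cut_spec : ∀ l, (cut ok l = (l, [])) ∨
    ∃ c t, l = (cut ok l).1 ++ c :: t ∧ (cut ok l).2 = records (c :: t) ∧
      ∀ x ∈ records (c :: t), ok x = true
  | [] => .inl rfl
  | c :: t => by
    by_cases h : (records (c :: t)).all ok = true
    · right
      refine ⟨c, t, ?_, ?_, ?_⟩
      · simp only [cut, h, if_true, List.nil_append]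
      · simp only [cut, h, if_true]
      · simpa only [List.all_eq_true] using h
    · rcases cut_spec t with h' | ⟨d, u, h1, h2, h3⟩
      · left
        simp only [cut, h, h']
        simp
      · right
        refine ⟨d, u, ?_, ?_, h3⟩
        · simp only [cut, h, Bool.false_eq_true, if_false, List.cons_append, ← h1]
        · simp only [cut, h, Bool.false_eq_true, if_false, h2]

/-- A suffix with `ok` records is cut off. -/
lemma cut_length_le : ∀ (A B : List Entry), B ≠ [] → (∀ x ∈ records B, ok x = true) →
    (cut ok (A ++ B)).1.length ≤ A.length
  | [], [], h, _ => absurd rfl h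
  | [], b :: B, _, h => by
    have : (records (b :: B)).all ok = true := by simpa only [List.all_eq_true] using h
    simp only [List.nil_append, cut, this, if_true]
    simp
  | a :: A, B, hB, h => by
    have := cut_length_le A B hB h
    rw [List.cons_append, cut]
    split_ifs
    · simp
    · simpa using this

/-! ### Trees given by a parent function -/

/-- The order of the tree with parent function `p`: `y` is reached from `x` by going up. -/
def le (p : ℕ → ℕ) (x y : ℕ) : Prop := ∃ k, p^[k] x = y

section Parent

variable {p : ℕ → ℕ}

lemma le_refl (x : ℕ) : le p x x := ⟨0, rfl⟩

lemma le_parent (x : ℕ) : le p x (p x) := ⟨1, rfl⟩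

lemma le_trans {x y z : ℕ} : le p x y → le p y z → le p x z := by
  rintro ⟨k, rfl⟩ ⟨j, rfl⟩
  exact ⟨j + k, Function.iterate_add_apply p j k x⟩

lemma le_parent_of_ne {x y : ℕ} (h : le p x y) (hne : x ≠ y) : le p (p x) y := by
  obtain ⟨_ | k, rfl⟩ := h
  · exact absurd rfl hne
  · exact ⟨k, (Function.iterate_succ_apply p k x).symm⟩

lemma le_linear {x y z : ℕ} : le p x y → le p x z → le p y z ∨ le p z y := by
  rintro ⟨k, rfl⟩ ⟨j, rfl⟩
  rcases Nat.le_total k j with h | h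
  · exact .inl ⟨j - k, by rw [← Function.iterate_add_apply, Nat.sub_add_cancel h]⟩
  · exact .inr ⟨k - j, by rw [← Function.iterate_add_apply, Nat.sub_add_cancel h]⟩

/-- The parent of every `x ≥ 1` is smaller than `x`. -/
structure IsParent (p : ℕ → ℕ) : Prop where
  zero : p 0 = 0
  lt : ∀ x, 1 ≤ x → p x < x

lemma IsParent.le_self (hp : IsParent p) (x : ℕ) : p x ≤ x := by
  rcases Nat.eq_zero_or_pos x with rfl | h
  · rw [hp.zero]
  · exact (hp.lt x h).le

lemma IsParent.iterate_le (hp : IsParent p) (k x : ℕ) : p^[k] x ≤ x := by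
  induction k generalizing x with
  | zero => exact Nat.le_refl _
  | succ k ih => exact (ih (p x)).trans (hp.le_self x)

lemma IsParent.ge (hp : IsParent p) {x y : ℕ} (h : le p x y) : y ≤ x := by
  obtain ⟨k, rfl⟩ := h
  exact hp.iterate_le k x

lemma IsParent.antisymm (hp : IsParent p) {x y : ℕ} (h : le p x y) (h' : le p y x) : x = y :=
  Nat.le_antisymm (hp.ge h') (hp.ge h)

lemma IsParent.le_zero (hp : IsParent p) (x : ℕ) : le p x 0 := by
  induction x using Nat.strong_induction_on with
  | _ x ih =>
    rcases Nat.eq_zero_or_pos x with rfl | h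
    · exact le_refl 0
    · exact le_trans (le_parent x) (ih _ (hp.lt x h))

/-- Parents decrease, so x steps suffice. This turns the order into a bounded search. -/
lemma IsParent.exists_iterate_le (hp : IsParent p) {x y : ℕ} (h : le p x y) :
    ∃ k < x + 1, p^[k] x = y := by
  induction x using Nat.strong_induction_on with
  | _ x ih =>
    by_cases hxy : x = y
    · exact ⟨0, by omega, hxy⟩
    · have h1 : 1 ≤ x := by
        by_contra h0
        have : x = 0 := by omega
        subst this
        exact hxy (Nat.le_antisymm (Nat.zero_le _) (hp.ge h))
      obtain ⟨k, hk, e⟩ := ih _ (hp.lt x h1) (le_parent_of_ne h hxy)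
      exact ⟨k + 1, by have := hp.lt x h1; omega, e⟩

lemma IsParent.finite_up (hp : IsParent p) (x : ℕ) : {y | le p x y}.Finite :=
  (Set.finite_Iic x).subset fun _ h => hp.ge h

theorem IsParent.isPosetTree (hp : IsParent p) : IsPosetTree (le p) :=
  ⟨le_refl, fun _ _ => hp.antisymm, fun _ _ _ => le_trans, ⟨0, hp.le_zero⟩,
    fun x => ⟨hp.finite_up x, fun _ _ => le_linear⟩⟩

lemma IsParent.isChildOf (hp : IsParent p) {x y : ℕ} (h : IsChildOf (le p) y x) :
    1 ≤ y ∧ p y = x := by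
  obtain ⟨h1, h2, h3⟩ := h
  have hy : 1 ≤ y := by have := hp.ge h1; omega
  refine ⟨hy, by_contra fun hne => h3 ⟨p y, ⟨le_parent y, (hp.lt y hy).ne'⟩,
    le_parent_of_ne h1 h2, hne⟩⟩

lemma le_of_chain {i j : ℕ} (h : ∀ x, i < x → x ≤ j → p x = x - 1) (hij : i ≤ j) : le p j i := by
  induction j, hij using Nat.le_induction with
  | base => exact le_refl i
  | succ j hij ih =>
    have h1 : le p (j + 1) j := by
      have h2 := le_parent (p := p) (j + 1)
      rwa [h _ (by omega) (by omega)] at h2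
    exact le_trans h1 (ih fun x h1 h2 => h x h1 (by omega))

/-! ### The shape of a module -/

/-- The elements from `m` on below `4 * m + 6 + 2 * Q` form a block: a chain from `m` to `2m-1`,
which has the children `2m` (a leaf) and `2m+1`, which in turn has two children, on top of a chain
of length `Q` and of a longer chain. -/
structure IsBlock (p : ℕ → ℕ) (m Q : ℕ) : Prop where
  pos : 1 ≤ m
  lt : p m < m
  fresh : ∀ x, x ≠ 0 → x < m → p x ≠ p m
  fork : p (2 * m + 1) = 2 * m - 1
  side : p (2 * m + 2 + Q) = 2 * m + 1
  chain : ∀ x, m < x → x < 4 * m + 6 + 2 * Q → x ≠ 2 * m + 1 → x ≠ 2 * m + 2 + Q → p x = x - 1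

namespace IsBlock

variable {m Q : ℕ}

lemma le_stem (b : IsBlock p m Q) {x : ℕ} (h1 : m ≤ x) (h2 : x < 2 * m) : le p (2 * m - 1) x :=
  le_of_chain (fun y _ _ => b.chain y (by omega) (by omega) (by omega) (by omega)) (by omega)

lemma fork_le (b : IsBlock p m Q) : le p (2 * m + 1) (2 * m - 1) :=
  b.fork ▸ le_parent (2 * m + 1)

lemma side_le (b : IsBlock p m Q) : le p (2 * m + 2 + Q) (2 * m + 1) :=
  b.side ▸ le_parent (2 * m + 2 + Q)

lemma le_side (b : IsBlock p m Q) {x : ℕ} (h1 : 2 * m + 2 + Q ≤ x) (h2 : x < 4 * m + 6 + 2 * Q) :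
    le p x (2 * m + 2 + Q) :=
  le_of_chain (fun y _ _ => b.chain y (by omega) (by omega) (by omega) (by omega)) h1

lemma last_le (b : IsBlock p m Q) {x : ℕ} (h1 : 2 * m + 2 + Q ≤ x) (h2 : x < 4 * m + 6 + 2 * Q) :
    le p (4 * m + 5 + 2 * Q) x :=
  le_of_chain (fun y _ _ => b.chain y (by omega) (by omega) (by omega) (by omega)) (by omega)

lemma last_le_fork (b : IsBlock p m Q) : le p (4 * m + 5 + 2 * Q) (2 * m + 1) :=
  le_trans (b.last_le (Nat.le_refl _) (by omega)) b.side_le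

lemma last_le_stem (b : IsBlock p m Q) {x : ℕ} (h1 : m ≤ x) (h2 : x < 2 * m) :
    le p (4 * m + 5 + 2 * Q) x :=
  le_trans b.last_le_fork (le_trans b.fork_le (b.le_stem h1 h2))

lemma le_tooth (b : IsBlock p m Q) {x : ℕ} (h1 : 2 * m + 2 ≤ x) (h2 : x < 2 * m + 2 + Q) :
    le p x (2 * m + 2) :=
  le_of_chain (fun y _ _ => b.chain y (by omega) (by omega) (by omega) (by omega)) h1

lemma le_fork (b : IsBlock p m Q) {x : ℕ} (h1 : 2 * m + 1 ≤ x) (h2 : x < 4 * m + 6 + 2 * Q) :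
    le p x (2 * m + 1) := by
  rcases Nat.lt_or_ge x (2 * m + 2 + Q) with h | h
  · exact le_of_chain (fun y _ _ => b.chain y (by omega) (by omega) (by omega) (by omega)) h1
  · exact le_trans (b.le_side h h2) b.side_le

lemma parent_leaf (b : IsBlock p m Q) : p (2 * m) = 2 * m - 1 :=
  b.chain _ (by have := b.pos; omega) (by omega) (by omega) (by omega)

lemma le_root (b : IsBlock p m Q) {x : ℕ} (h1 : 2 * m - 1 ≤ x) (h2 : x < 4 * m + 6 + 2 * Q) :
    le p x (2 * m - 1) := by
  rcases Nat.lt_or_ge x (2 * m + 1) with h | h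
  · exact le_of_chain (fun y _ _ => b.chain y (by have := b.pos; omega) (by omega) (by omega)
      (by omega)) h1
  · exact le_trans (b.le_fork h h2) b.fork_le

lemma le_start (b : IsBlock p m Q) {x : ℕ} (h1 : m ≤ x) (h2 : x < 4 * m + 6 + 2 * Q) :
    le p x m := by
  rcases Nat.lt_or_ge x (2 * m - 1) with h | h
  · exact le_of_chain (fun y _ _ => b.chain y (by omega) (by omega) (by omega) (by omega)) h1
  · exact le_trans (b.le_root h h2) (b.le_stem (Nat.le_refl m) (by have := b.pos; omega))

/-- The bound on u matters: the tree may later resume growing at 2m. -/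
lemma eq_leaf (hp : IsParent p) (b : IsBlock p m Q) {u : ℕ} (hu : u < 4 * m + 6 + 2 * Q)
    (h : le p u (2 * m)) : u = 2 * m := by
  have hm := b.pos
  induction u using Nat.strong_induction_on with
  | _ u ih =>
    by_contra hne
    have h1 := hp.ge h
    have h2 := le_parent_of_ne h hne
    by_cases hf : u = 2 * m + 1
    · rw [hf, b.fork] at h2
      have := hp.ge h2
      omega
    by_cases hs : u = 2 * m + 2 + Q
    · rw [hs, b.side] at h2
      have := ih (2 * m + 1) (by omega) (by omega) h2
      omega
    · rw [b.chain u (by omega) hu hf hs] at h2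
      have := ih (u - 1) (by omega) (by omega) h2
      omega

lemma lt_side (hp : IsParent p) (b : IsBlock p m Q) {u x : ℕ} (hx1 : 2 * m + 2 ≤ x)
    (hx2 : x < 2 * m + 2 + Q) (hu : u < 4 * m + 6 + 2 * Q) (h : le p u x) :
    u < 2 * m + 2 + Q := by
  induction u using Nat.strong_induction_on with
  | _ u ih =>
    by_contra hge
    have h2 := le_parent_of_ne h (by omega)
    by_cases hs : u = 2 * m + 2 + Q
    · rw [hs, b.side] at h2
      have := hp.ge h2
      omega
    · rw [b.chain u (by omega) hu (by omega) hs] at h2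
      have := ih (u - 1) (by omega) (by omega) h2
      omega

end IsBlock

/-! ### Branching in a tree made of blocks -/

/-- Every element except the root lies in a block. -/
def IsCovered (p : ℕ → ℕ) : Prop :=
  ∀ y, 1 ≤ y → ∃ m Q, IsBlock p m Q ∧ m ≤ y ∧ y < 4 * m + 6 + 2 * Q

/-- Apart from the start of a block, its fork and its side, the parent of z is z - 1, which leaves
no room for an older sibling. The start has none by `fresh`. -/
lemma IsCovered.siblings (hp : IsParent p) (hc : IsCovered p) {y z : ℕ} (hy : 1 ≤ y) (hyz : y < z)
    (h : p y = p z) : ∃ m Q, IsBlock p m Q ∧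
      ((y = 2 * m ∧ p z = 2 * m - 1) ∨ (y = 2 * m + 2 ∧ p z = 2 * m + 1)) := by
  obtain ⟨m, Q, b, h1, h2⟩ := hc z (by omega)
  have hm := b.pos
  refine ⟨m, Q, b, ?_⟩
  have hlt := hp.lt y hy
  rcases eq_or_lt_of_le h1 with rfl | h1
  · exact absurd h (b.fresh y (by omega) hyz)
  by_cases hf : z = 2 * m + 1
  · subst hf
    rw [b.fork] at h ⊢
    left
    omega
  by_cases hs : z = 2 * m + 2 + Q
  · subst hs
    rw [b.side] at h ⊢
    right
    have := b.chain y (by omega) (by omega) (by omega) (by omega)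
    omega
  · have := b.chain z h1 h2 hf hs
    omega

/-- By `IsCovered.siblings` a child with a younger sibling is the successor of the parent. Among
three children this would hold for two of them. -/
lemma IsCovered.isBinaryTree (hp : IsParent p) (hc : IsCovered p) : IsBinaryTree (le p) := by
  intro x
  by_contra hlt
  push Not at hlt
  have key : ∀ {y z w : ℕ}, y < z → z < w → IsChildOf (le p) y x → IsChildOf (le p) z x →
      IsChildOf (le p) w x → False := by
    intro y z w hyz hzw hy hz hw
    obtain ⟨hy1, hy2⟩ := hp.isChildOf hy
    obtain ⟨hz1, hz2⟩ := hp.isChildOf hz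
    obtain ⟨hw1, hw2⟩ := hp.isChildOf hw
    obtain ⟨m, Q, b, h1⟩ := hc.siblings hp hy1 (hyz.trans hzw) (hy2.trans hw2.symm)
    obtain ⟨m', Q', b', h2⟩ := hc.siblings hp hz1 hzw (by omega)
    have := b.pos
    have := b'.pos
    omega
  obtain ⟨t, ht, h3⟩ := Set.exists_subset_encard_eq (k := 3) (Order.add_one_le_of_lt hlt)
  obtain ⟨a, b, c, hab, hac, hbc, rfl⟩ := Set.encard_eq_three.1 h3
  have ha := ht (Set.mem_insert a _)
  have hb := ht (Set.mem_insert_of_mem a (Set.mem_insert b _))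
  have hc := ht (Set.mem_insert_of_mem a (Set.mem_insert_of_mem b (Set.mem_singleton c)))
  rcases lt_or_gt_of_ne hab with h1 | h1 <;> rcases lt_or_gt_of_ne hac with h2 | h2 <;>
    rcases lt_or_gt_of_ne hbc with h3 | h3
  all_goals first
    | exact key h1 h3 ha hb hc
    | exact key h2 h3 ha hc hb
    | exact key h1 h2 hb ha hc
    | exact key h3 h2 hb hc ha
    | exact key h2 h1 hc ha hb
    | exact key h3 h1 hc hb ha

lemma IsCovered.isBranchingNode (hp : IsParent p) (hc : IsCovered p) {x : ℕ}
    (h : IsBranchingNode (le p) x) : ∃ m Q, IsBlock p m Q ∧ (x = 2 * m - 1 ∨ x = 2 * m + 1) := by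
  obtain ⟨y, z, hne, hy, hz⟩ := h
  obtain ⟨hy, hy'⟩ := hp.isChildOf hy
  obtain ⟨hz, hz'⟩ := hp.isChildOf hz
  rcases lt_or_gt_of_ne hne with h | h
  · obtain ⟨m, Q, b, h1⟩ := hc.siblings hp hy h (by omega)
    exact ⟨m, Q, b, by omega⟩
  · obtain ⟨m, Q, b, h1⟩ := hc.siblings hp hz h (by omega)
    exact ⟨m, Q, b, by omega⟩

lemma IsParent.encard_up_lt (hp : IsParent p) {x y : ℕ} (h : le p y x) (hne : x ≠ y) :
    {z | le p x z}.encard < {z | le p y z}.encard := by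
  refine (hp.finite_up x).encard_lt_encard ⟨fun z hz => le_trans h hz, fun hsub => ?_⟩
  exact hne (hp.antisymm (hsub (le_refl y)) h)

/-- Levels increase strictly along the branching nodes: a node older than m' has at most m' elements
above or equal to it, while the stem of the block at m' and the root already give m' + 1. -/
lemma IsCovered.isUniquelyBranching (hp : IsParent p) (hc : IsCovered p) :
    IsUniquelyBranching (le p) := by
  have key : ∀ {x y : ℕ}, x < y → IsBranchingNode (le p) x → IsBranchingNode (le p) y →
      {z | le p x z}.encard < {z | le p y z}.encard := by
    intro x y hxy hx hy
    obtain ⟨m, Q, b, h1⟩ := hc.isBranchingNode hp hx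
    obtain ⟨m', Q', b', h2⟩ := hc.isBranchingNode hp hy
    have := b.pos
    have := b'.pos
    have hstem : ∀ {z}, m' ≤ z → z < 2 * m' → le p y z := by
      intro z hz1 hz2
      rcases h2 with rfl | rfl
      · exact b'.le_stem hz1 hz2
      · exact le_trans b'.fork_le (b'.le_stem hz1 hz2)
    rcases Nat.lt_or_ge x m' with h | h
    · have hle : {z | le p x z}.encard ≤ (x + 1 : ℕ) := by
        refine (Set.encard_le_encard (t := (Finset.range (x + 1) : Set ℕ)) fun z hz => ?_).trans ?_
        · have := hp.ge hz
          simp only [Finset.coe_range, Set.mem_Iio]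
          omega
        · rw [Set.encard_coe_eq_coe_finsetCard, Finset.card_range]
      have hge : ((m' + 1 : ℕ) : ℕ∞) ≤ {z | le p y z}.encard := by
        refine _root_.le_trans ?_ (Set.encard_le_encard
          (s := ((insert 0 (Finset.Ico m' (2 * m')) : Finset ℕ) : Set ℕ)) fun z hz => ?_)
        · rw [Set.encard_coe_eq_coe_finsetCard, Finset.card_insert_of_notMem (by simp only [Finset.mem_Ico]; omega),
            Nat.card_Ico]
          norm_cast
          omega
        · simp only [Finset.coe_insert, Finset.coe_Ico, Set.mem_insert_iff, Set.mem_Ico] at hz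
          rcases hz with rfl | hz
          · exact hp.le_zero y
          · exact hstem hz.1 hz.2
      exact lt_of_le_of_lt hle (lt_of_lt_of_le (by norm_cast; omega) hge)
    -- Branching nodes are odd, so m' ≤ x < y ≤ 2m' + 1 puts x on the stem.
    · exact hp.encard_up_lt (hstem h (by omega)) hxy.ne
  intro n x y hx hy hxn hyn
  by_contra hne
  rcases lt_or_gt_of_ne hne with h | h
  · exact absurd (key h hx hy) (by rw [hxn, hyn]; exact lt_irrefl _)
  · exact absurd (key h hy hx) (by rw [hxn, hyn]; exact lt_irrefl _)

end Parent

/-! ### The construction -/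

/-- The parents of the elements built so far, the leaf where the tree grows, and the stack. -/
abbrev State := List ℕ × ℕ × List Entry

/-- The length of the tooth of a module. -/
def width (E : Entry) : ℕ := E.2.1 - E.1

/-- The element of a module which starts the longer branch. -/
def side (E : Entry) : ℕ := 2 * E.2.2 + 2 + width E

/-- The last element of a module. -/
def bottom (E : Entry) : ℕ := 4 * E.2.2 + 5 + 2 * width E

/-- The parents of the elements of a block of size `Q` which starts with `m` below `l`. -/
def block (l m Q : ℕ) : List ℕ :=
  (List.range (3 * m + 6 + 2 * Q)).map fun i =>
    if i = 0 then l else if i = m + 1 then 2 * m - 1 else if i = m + 2 + Q then 2 * m + 1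
    else m + i - 1

/-- Add a module with the given requirement and era. -/
def push (X : State) (r : ℕ × ℕ) : State :=
  (X.1 ++ block X.2.1 X.1.length (r.2 - r.1), 4 * X.1.length + 5 + 2 * (r.2 - r.1),
    X.2.2 ++ [(r.1, r.2, X.1.length)])

/-- `y` is reached from `x` by going up, with parents read from the list `ps`. -/
def Reaches (ps : List ℕ) (x y : ℕ) : Prop := ∃ k < x + 1, (fun z => ps.getD z 0)^[k] x = y

/-- The map with code `c`. -/
def decodeMap (c i : ℕ) : ℕ := (Denumerable.ofNat (List ℕ) c).getD i 0

/-- The relation with index `e` of the sequence of relations coded by `R`. -/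
def Rel (R : ℕ → Bool) (e x y : ℕ) : Prop := R (Nat.pair e (Nat.pair x y)) = true

/-- The map `g` embeds the elements up to `d` in the relation `S`, and the elements up to `n`
which it does not hit are below `g d`. -/
structure IsCommitment (p : ℕ → ℕ) (S : ℕ → ℕ → Prop) (n d : ℕ) (g : ℕ → ℕ) : Prop where
  le_size : ∀ i < d + 1, g i < n + 1
  iff : ∀ i < d + 1, ∀ j < d + 1, (le p i j ↔ S (g i) (g j))
  rest : ∀ y < n + 1, (∃ i < d + 1, g i = y) ∨ S y (g d)

/-- The relation with the index of the module `E` agrees with the tree up to `side E`, in a way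
that is found with little effort. -/
def Commits (R : ℕ → Bool) (ps : List ℕ) (E : Entry) : Prop :=
  E.1 ≤ ps.length ∧ ∃ c < ps.length,
    (∀ i < side E + 1, decodeMap c i < ps.length + 1) ∧
    (∀ i < side E + 1, ∀ j < side E + 1,
      (Reaches ps i j ↔ Rel R E.1 (decodeMap c i) (decodeMap c j))) ∧
    ∀ y < ps.length + 1, (∃ i < side E + 1, decodeMap c i = y) ∨
      Rel R E.1 y (decodeMap c (side E))

open Classical in
/-- The test for `Commits`. -/
noncomputable def commits (R : ℕ → Bool) (ps : List ℕ) (E : Entry) : Bool := decide (Commits R ps E)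

/-- Requirement `v` and those of the list, each with the era of the next one. -/
def reassign (n : ℕ) : ℕ → List Entry → List (ℕ × ℕ)
  | v, [] => [(v, n)]
  | v, c :: t => (v, c.2.1) :: reassign n c.1 t

/-- The requirement that comes first when the records `ρ` have been cut off from `σ`. -/
def newReq (σ ρ : List Entry) : ℕ :=
  max (σ.getLast?.elim 0 fun c => c.1 + 1) (ρ.head?.elim 0 fun c => c.1 + 1)

/-- The modules that are built when the records `ρ` have been cut off from `σ`. -/
def todo (n : ℕ) (σ ρ : List Entry) : List (ℕ × ℕ) :=
  (reassign (n + 2) (newReq σ ρ) ρ).filter fun r => r.1 + 2 ≤ r.2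

/-- Build new modules when the records `ρ` have been cut off from `σ`. -/
def rebuild (X : State) (σ ρ : List Entry) : State :=
  (todo X.1.length σ ρ).foldl push (X.1, ρ.head?.elim X.2.1 fun c => 2 * c.2.2, σ)

/-- One step of the construction. -/
noncomputable def step (R : ℕ → Bool) (X : State) : State :=
  rebuild X (cut (commits R X.1) X.2.2).1 (cut (commits R X.1) X.2.2).2

/-- The stages of the construction. -/
noncomputable def stage (R : ℕ → Bool) : ℕ → State
  | 0 => ([0], 0, [])
  | s + 1 => step R (stage R s)

/-- The parent function of the tree. -/
noncomputable def parent (R : ℕ → Bool) (x : ℕ) : ℕ := (stage R x).1.getD x 0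

lemma length_block (l m Q : ℕ) : (block l m Q).length = 3 * m + 6 + 2 * Q := by simp [block]

lemma length_push (X : State) (r : ℕ × ℕ) :
    (push X r).1.length = 4 * X.1.length + 6 + 2 * (r.2 - r.1) := by
  simp only [push, List.length_append, length_block]
  omega

/-! ### Invariants of the tree under construction -/

/-- The function `p` gives the parents in the list `ps`. -/
def Agrees (p : ℕ → ℕ) (ps : List ℕ) : Prop := ∀ x < ps.length, p x = ps.getD x 0

lemma Agrees.of_prefix {p : ℕ → ℕ} {ps qs : List ℕ} (h : Agrees p qs) (hpq : ps <+: qs) :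
    Agrees p ps := by
  obtain ⟨t, rfl⟩ := hpq
  intro x hx
  rw [h x (by rw [List.length_append]; omega), List.getD_append _ _ _ _ hx]

lemma Agrees.block_apply {p : ℕ → ℕ} {ps : List ℕ} {l Q : ℕ}
    (h : Agrees p (ps ++ block l ps.length Q)) {i : ℕ} (hi : i < 3 * ps.length + 6 + 2 * Q) :
    p (ps.length + i) = if i = 0 then l else if i = ps.length + 1 then 2 * ps.length - 1 else
      if i = ps.length + 2 + Q then 2 * ps.length + 1 else ps.length + i - 1 := by
  rw [h _ (by rw [List.length_append, length_block]; omega), List.getD_append_right _ _ _ _ (by omega),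
    Nat.add_sub_cancel_left, List.getD_eq_getElem _ _ (by rw [length_block]; exact hi)]
  simp only [block, List.getElem_map, List.getElem_range]

lemma prefix_push (X : State) (r : ℕ × ℕ) : X.1 <+: (push X r).1 := List.prefix_append _ _

lemma prefix_foldl (L : List (ℕ × ℕ)) : ∀ X : State, X.1 <+: (L.foldl push X).1 := by
  induction L with
  | nil => exact fun X => List.prefix_refl _
  | cons r L ih => exact fun X => (prefix_push X r).trans (ih (push X r))

/-- The state `X` is as it should be. -/
structure Valid (p : ℕ → ℕ) (X : State) : Prop where
  pos : 1 ≤ X.1.length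
  zero : p 0 = 0
  leaf_lt : X.2.1 < X.1.length
  leaf : ∀ x, x ≠ 0 → x < X.1.length → p x ≠ X.2.1
  cover : ∀ y, 1 ≤ y → y < X.1.length → ∃ m Q, IsBlock p m Q ∧ m ≤ y ∧ y < 4 * m + 6 + 2 * Q
  block : ∀ E ∈ X.2.2, IsBlock p E.2.2 (width E)
  bottom_le : ∀ E ∈ X.2.2, bottom E ≤ X.2.1
  le_bottom : ∀ E ∈ X.2.2, ∀ x, bottom E ≤ x → x < X.1.length → le p x (bottom E)
  sorted : X.2.2.Pairwise fun E F => bottom E < F.2.2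

lemma IsBlock.parent_lt {p : ℕ → ℕ} {m Q x : ℕ} (b : IsBlock p m Q) (h1 : m ≤ x)
    (h2 : x < 4 * m + 6 + 2 * Q) : p x < x := by
  have hm := b.pos
  have hl := b.lt
  rcases eq_or_lt_of_le h1 with rfl | h1
  · exact hl
  by_cases hf : x = 2 * m + 1
  · rw [hf, b.fork]; omega
  by_cases hs : x = 2 * m + 2 + Q
  · rw [hs, b.side]; omega
  · rw [b.chain x h1 h2 hf hs]; omega

variable {p : ℕ → ℕ} {X : State}

lemma Valid.parent_lt (h : Valid p X) {x : ℕ} (h1 : 1 ≤ x) (h2 : x < X.1.length) : p x < x := by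
  obtain ⟨m, Q, b, h3, h4⟩ := h.cover x h1 h2
  exact b.parent_lt h3 h4

lemma Valid.bottom_lt (h : Valid p X) {E : Entry} (hE : E ∈ X.2.2) : bottom E < X.1.length :=
  (h.bottom_le E hE).trans_lt h.leaf_lt

lemma Valid.isBlock_push (h : Valid p X) {r : ℕ × ℕ} (ha : Agrees p (push X r).1) :
    IsBlock p X.1.length (r.2 - r.1) ∧ p X.1.length = X.2.1 := by
  have hpos := h.pos
  have happ : ∀ i, i < 3 * X.1.length + 6 + 2 * (r.2 - r.1) → _ :=
    fun i hi => Agrees.block_apply ha hi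
  have h0 : p X.1.length = X.2.1 := by simpa using happ 0 (by omega)
  refine ⟨⟨hpos, by rw [h0]; exact h.leaf_lt, fun x hx hx' => by rw [h0]; exact h.leaf x hx hx',
    ?_, ?_, ?_⟩, h0⟩
  · have := happ (X.1.length + 1) (by omega)
    rw [if_neg (by omega), if_pos rfl] at this
    rw [← this]; congr 1; omega
  · have := happ (X.1.length + 2 + (r.2 - r.1)) (by omega)
    rw [if_neg (by omega), if_neg (by omega), if_pos rfl] at this
    rw [← this]; congr 1; omega
  · intro x h1 h2 h3 h4
    have := happ (x - X.1.length) (by omega)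
    rw [if_neg (by omega), if_neg (by omega), if_neg (by omega)] at this
    rw [show X.1.length + (x - X.1.length) = x by omega] at this
    exact this

lemma Valid.of_push (h : Valid p X) {r : ℕ × ℕ} (ha : Agrees p (push X r).1) : Valid p (push X r) := by
  obtain ⟨b, h0⟩ := h.isBlock_push ha
  have hpos := h.pos
  have hlen := length_push X r
  have hcov : ∀ y, 1 ≤ y → y < (push X r).1.length →
      ∃ m Q, IsBlock p m Q ∧ m ≤ y ∧ y < 4 * m + 6 + 2 * Q := by
    intro y h1 h2
    rcases Nat.lt_or_ge y X.1.length with h3 | h3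
    · exact h.cover y h1 h3
    · exact ⟨_, _, b, h3, by omega⟩
  have hbot : ∀ E, E ∈ (push X r).2.2 →
      E ∈ X.2.2 ∨ E = (r.1, r.2, X.1.length) := fun E hE => by
    simpa [push] using hE
  constructor
  · omega
  · exact h.zero
  · rw [hlen]
    simp only [push]
    omega
  · intro x h1 h2
    obtain ⟨m, Q, b', h3, h4⟩ := hcov x (by omega) h2
    have := b'.parent_lt h3 h4
    simp only [push]
    omega
  · exact hcov
  · intro E hE
    rcases hbot E hE with hE | rfl
    · exact h.block E hE
    · exact b
  · intro E hE
    rcases hbot E hE with hE | rfl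
    · have := h.bottom_lt hE
      simp only [push]
      omega
    · simp only [push, bottom, width]
      omega
  · intro E hE x h1 h2
    rcases hbot E hE with hE | rfl
    · rcases Nat.lt_or_ge x X.1.length with h3 | h3
      · exact h.le_bottom E hE x h1 h3
      · refine le_trans (b.le_start h3 (by omega)) (le_trans (le_parent _) ?_)
        rw [h0]
        exact h.le_bottom E hE _ (h.bottom_le E hE) h.leaf_lt
    · simp only [bottom, width] at h1 ⊢
      rw [show x = 4 * X.1.length + 5 + 2 * (r.2 - r.1) by omega]
      exact le_refl _
  · simp only [push]
    rw [List.pairwise_append]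
    refine ⟨h.sorted, List.pairwise_singleton _ _, fun E hE F hF => ?_⟩
    rw [List.mem_singleton.1 hF]
    exact h.bottom_lt hE

lemma Valid.of_foldl {L : List (ℕ × ℕ)} : ∀ {X : State}, Valid p X → Agrees p (L.foldl push X).1 →
    Valid p (L.foldl push X) := by
  induction L with
  | nil => exact fun h _ => h
  | cons r L ih => exact fun h ha => ih (h.of_push (ha.of_prefix (prefix_foldl L _))) ha

/-- The state after the stack was cut before the entry `c`. -/
lemma Valid.of_cut (h : Valid p X) {σ t : List Entry} {c : Entry} (hst : X.2.2 = σ ++ c :: t) :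
    Valid p (X.1, 2 * c.2.2, σ) := by
  have hc : c ∈ X.2.2 := by rw [hst]; simp
  have b := h.block c hc
  have hb := h.bottom_lt hc
  have hsub : ∀ E ∈ σ, E ∈ X.2.2 := fun E hE => by rw [hst]; simp [hE]
  have hs := h.sorted
  rw [hst, List.pairwise_append] at hs
  refine ⟨h.pos, h.zero, ?_, ?_, h.cover, fun E hE => h.block E (hsub E hE), fun E hE => ?_,
    fun E hE => h.le_bottom E (hsub E hE), hs.1⟩
  · simp only [bottom] at hb ⊢
    omega
  -- Nothing was attached to the leaf of c: an element after its start lies in the block of c or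
  -- strictly below its bottom.
  · intro x h0 hx hx'
    dsimp only at hx hx'
    have hlt := h.parent_lt (Nat.one_le_iff_ne_zero.2 h0) hx
    have hpos := b.pos
    rcases Nat.lt_or_ge x (bottom c + 1) with h1 | h1
    · simp only [bottom] at h1
      by_cases hf : x = 2 * c.2.2 + 1
      · rw [hf, b.fork] at hx'; omega
      by_cases hd : x = 2 * c.2.2 + 2 + width c
      · rw [hd, b.side] at hx'; omega
      · have := b.chain x (by omega) (by omega) hf hd
        omega
    · have h2 := le_parent_of_ne (h.le_bottom c hc x (by omega) hx) (by omega)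
      rw [hx'] at h2
      -- `IsParent` is not available here, as it is deduced from the validity of all stages.
      have h3 : ∀ u v, u < X.1.length → le p u v → v ≤ u := by
        intro u v hu
        rintro ⟨k, rfl⟩
        clear h2
        induction k generalizing u with
        | zero => exact Nat.le_refl _
        | succ k ih =>
          rw [Function.iterate_succ_apply]
          rcases Nat.eq_zero_or_pos u with rfl | hu0
          · rw [h.zero]; exact ih 0 hu
          · have := h.parent_lt hu0 hu
            exact (ih (p u) (by omega)).trans this.le
      have := h3 _ _ (by simp only [bottom] at hb; omega) h2
      simp only [bottom] at this
      omega
  · have := hs.2.2 E hE c List.mem_cons_self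
    dsimp only
    omega

lemma head?_records (c : Entry) (t : List Entry) : (records (c :: t)).head? = some c := by
  rw [records_cons, List.head?_cons]

/-- The two possible forms of a step. -/
lemma step_cases (R : ℕ → Bool) (X : State) :
    step R X = (todo X.1.length X.2.2 []).foldl push X ∨
    ∃ σ c t, X.2.2 = σ ++ c :: t ∧ (∀ E ∈ records (c :: t), Commits R X.1 E) ∧
      step R X = (todo X.1.length σ (records (c :: t))).foldl push (X.1, 2 * c.2.2, σ) := by
  rcases cut_spec (commits R X.1) X.2.2 with h | ⟨c, t, h1, h2, h3⟩
  · left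
    simp only [step, h]
    rfl
  · right
    refine ⟨_, c, t, h1, fun E hE => ?_, ?_⟩
    · simpa [commits] using h3 E hE
    · rw [step, rebuild, h2, head?_records]
      rfl

lemma prefix_step (R : ℕ → Bool) (X : State) : X.1 <+: (step R X).1 := by
  rcases step_cases R X with h | ⟨σ, c, t, -, -, h⟩ <;> rw [h]
  · exact prefix_foldl _ _
  · exact prefix_foldl _ (X.1, 2 * c.2.2, σ)

lemma Valid.of_step {R : ℕ → Bool} (h : Valid p X) (ha : Agrees p (step R X).1) :
    Valid p (step R X) := by
  rcases step_cases R X with h' | ⟨σ, c, t, h1, -, h'⟩ <;> rw [h'] at ha ⊢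
  · exact h.of_foldl ha
  · exact (h.of_cut h1).of_foldl ha

/-! ### The modules on the stack -/

/-- After the last entry with requirement `b` there is one with a smaller requirement. -/
def Free (b : ℕ) : List Entry → Prop
  | [] => True
  | c :: t => (c.1 = b → ∃ z ∈ t, z.1 < b) ∧ Free b t

lemma free_of_ne {b : ℕ} : ∀ {A : List Entry}, (∀ z ∈ A, z.1 ≠ b) → Free b A
  | [], _ => trivial
  | c :: _, h => ⟨fun hc => absurd hc (h c List.mem_cons_self),
    free_of_ne fun z hz => h z (List.mem_cons_of_mem _ hz)⟩

lemma Free.append {b : ℕ} {B : List Entry} (hB : ∀ z ∈ B, z.1 ≠ b) :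
    ∀ {A : List Entry}, Free b A → Free b (A ++ B)
  | [], _ => free_of_ne hB
  | c :: A, h => ⟨fun hc => by
      obtain ⟨z, hz, hz'⟩ := h.1 hc
      exact ⟨z, List.mem_append_left _ hz, hz'⟩, Free.append hB h.2⟩

lemma Free.of_append {b : ℕ} {B : List Entry} (hB : ∀ z ∈ B, b < z.1) :
    ∀ {A : List Entry}, Free b (A ++ B) → Free b A
  | [], _ => trivial
  | c :: A, h => ⟨fun hc => by
      obtain ⟨z, hz, hz'⟩ := h.1 hc
      rcases List.mem_append.1 hz with hz | hz
      · exact ⟨z, hz, hz'⟩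
      · exact absurd (hB z hz) hz'.not_gt, Free.of_append hB h.2⟩

lemma free_concat_lt {b : ℕ} {x : Entry} (hx : x.1 < b) : ∀ A : List Entry, Free b (A ++ [x])
  | [] => ⟨fun h => absurd h hx.ne, trivial⟩
  | _ :: A => ⟨fun _ => ⟨x, by simp, hx⟩, free_concat_lt hx A⟩

/-- For this reason `newReq` lies above the last requirement that is kept. -/
lemma free_of_getLast? {b : ℕ} {A : List Entry} (h : A.getLast?.elim 0 (fun c => c.1 + 1) ≤ b) :
    Free b A := by
  rcases List.eq_nil_or_concat A with rfl | ⟨A, x, rfl⟩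
  · trivial
  · simp only [List.concat_eq_append, List.getLast?_append, List.getLast?_singleton] at h
    exact List.concat_eq_append ▸ free_concat_lt (by simpa using h) A

/-- Each further entry with requirement b uses up a smaller one since the previous such entry. If
the list is `Free`, the last of them is also followed by a smaller one, which saves the summand 1.
-/
lemma count_eq_le {b : ℕ} (A : List Entry) :
    (∀ C x, C ++ [x] <+: A → Free x.1 C) →
    A.countP (fun x => x.1 = b) ≤ A.countP (fun x => x.1 < b) + 1 ∧
    (Free b A → A.countP (fun x => x.1 = b) ≤ A.countP (fun x => x.1 < b)) := by
  induction A using List.reverseRecOn with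
  | nil => simp
  | append_singleton A x ih =>
    intro h
    obtain ⟨h1, h2⟩ := ih fun C y hC => h C y (hC.trans (List.prefix_append _ _))
    have h3 := h A x (List.prefix_refl _)
    simp only [List.countP_append, List.countP_singleton, decide_eq_true_eq]
    rcases lt_trichotomy x.1 b with hx | hx | hx
    · simp only [hx, hx.ne, if_true, if_false]
      omega
    · rw [hx] at h3
      have := h2 h3
      simp only [hx, lt_irrefl, if_true, if_false]
      refine ⟨by omega, fun hf => ?_⟩
      exfalso
      clear ih h h1 h2 h3 this
      induction A with
      | nil => simpa using hf.1 hx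
      | cons a A ih => exact ih hf.2
    · simp only [hx.not_gt, hx.ne', if_false]
      exact ⟨by omega, fun hf => by
        have := h2 (hf.of_append (B := [x]) (by simpa using hx))
        omega⟩

/-- A list in which equal requirements are separated by smaller ones has few small ones. -/
lemma count_lt_le {A : List Entry} (h : ∀ C x, C ++ [x] <+: A → Free x.1 C) (b : ℕ) :
    A.countP (fun x => x.1 < b) + 1 ≤ 2 ^ b := by
  induction b with
  | zero => simp
  | succ b ih =>
    have h1 := (count_eq_le (b := b) A h).1
    have h2 : A.countP (fun x => x.1 < b + 1) =
        A.countP (fun x => x.1 < b) + A.countP (fun x => x.1 = b) := by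
      clear h h1 ih
      induction A with
      | nil => rfl
      | cons a A ih =>
        simp only [List.countP_cons, decide_eq_true_eq] at ih ⊢
        rcases lt_trichotomy a.1 b with h | h | h
        · simp only [h, h.ne, Nat.lt_succ_of_lt h, if_true, if_false]; omega
        · simp only [h, Nat.lt_succ_self, lt_irrefl, if_true, if_false]; omega
        · rw [if_neg (by omega), if_neg (by omega), if_neg (by omega)]; omega
    rw [pow_succ]
    omega

/-- The list `l` of modules of a tree of size `n` is as it should be. -/
structure Tidy (n : ℕ) (l : List Entry) : Prop where
  add_two_le : ∀ E ∈ l, E.1 + 2 ≤ E.2.1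
  era_lt : ∀ E ∈ l, E.2.1 < n
  rise : l.Pairwise fun E F => F.1 < E.1 → E.2.1 < F.2.1
  free : ∀ C E, C ++ [E] <+: l → Free E.1 C

lemma Tidy.mono {n m : ℕ} {l k : List Entry} (h : Tidy n l) (hnm : n ≤ m) (hk : k <+: l) :
    Tidy m k :=
  ⟨fun E hE => h.add_two_le E (hk.subset hE), fun E hE => (h.era_lt E (hk.subset hE)).trans_le hnm,
    h.rise.sublist hk.sublist, fun C E hC => h.free C E (hC.trans hk)⟩

lemma Tidy.of_push {X : State} (h : Tidy X.1.length X.2.2) {r : ℕ × ℕ} (h1 : r.1 + 2 ≤ r.2)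
    (h2 : r.2 ≤ X.1.length + 2) (h3 : ∀ E ∈ X.2.2, r.1 < E.1 → E.2.1 < r.2) (h4 : Free r.1 X.2.2) :
    Tidy (push X r).1.length (push X r).2.2 := by
  rw [length_push]
  constructor
  · intro E hE
    rcases List.mem_append.1 hE with hE | hE
    · exact h.add_two_le E hE
    · rw [List.mem_singleton.1 hE]
      exact h1
  · intro E hE
    rcases List.mem_append.1 hE with hE | hE
    · have := h.era_lt E hE
      omega
    · rw [List.mem_singleton.1 hE]
      dsimp only
      omega
  · refine List.pairwise_append.2 ⟨h.rise, List.pairwise_singleton _ _, fun E hE F hF => ?_⟩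
    rw [List.mem_singleton.1 hF]
    exact h3 E hE
  · intro C E hC
    rcases List.prefix_concat_iff.1 hC with hC | hC
    · obtain ⟨rfl, hE⟩ := List.append_inj' hC rfl
      simp only [List.cons.injEq, and_true] at hE
      rw [hE]
      exact h4
    · exact h.free C E hC

/-- Among the new entries requirements fall and eras rise, so each needs to be compared only with
the old stack. -/
lemma Tidy.of_foldl : ∀ {L : List (ℕ × ℕ)} {X : State}, Tidy X.1.length X.2.2 →
    (L.Pairwise fun r r' => r'.1 < r.1 ∧ r.2 < r'.2) →
    (∀ r ∈ L, r.1 + 2 ≤ r.2 ∧ r.2 ≤ X.1.length + 2 ∧ (∀ E ∈ X.2.2, r.1 < E.1 → E.2.1 < r.2) ∧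
      Free r.1 X.2.2) → Tidy (L.foldl push X).1.length (L.foldl push X).2.2
  | [], _, h, _, _ => h
  | r :: L, X, h, hp, hr => by
    obtain ⟨h1, h2, h3, h4⟩ := hr r List.mem_cons_self
    rw [List.pairwise_cons] at hp
    refine Tidy.of_foldl (L := L) (X := push X r) (h.of_push h1 h2 h3 h4) hp.2 fun q hq => ?_
    obtain ⟨h1', h2', h3', h4'⟩ := hr q (List.mem_cons_of_mem _ hq)
    have hqr := hp.1 q hq
    refine ⟨h1', ?_, fun E hE => ?_, h4'.append ?_⟩
    · rw [length_push]
      omega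
    · rcases List.mem_append.1 hE with hE | hE
      · exact h3' E hE
      · rw [List.mem_singleton.1 hE]
        exact fun _ => hqr.2
    · intro z hz
      rw [List.mem_singleton.1 hz]
      exact hqr.1.ne'

/-! ### Eras of the modules built after a cut -/

lemma mem_reassign {n : ℕ} {r : ℕ × ℕ} : ∀ {ρ : List Entry} {v : ℕ}, r ∈ reassign n v ρ →
    (r.1 = v ∨ ∃ E ∈ ρ, r.1 = E.1) ∧ (r.2 = n ∨ ∃ E ∈ ρ, r.2 = E.2.1)
  | [], v, h => by
    rw [reassign, List.mem_singleton] at h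
    subst h
    exact ⟨.inl rfl, .inl rfl⟩
  | c :: t, v, h => by
    rw [reassign, List.mem_cons] at h
    rcases h with rfl | h
    · exact ⟨.inl rfl, .inr ⟨c, List.mem_cons_self, rfl⟩⟩
    · obtain ⟨h1, h2⟩ := mem_reassign h
      refine ⟨.inr ?_, ?_⟩
      · rcases h1 with h1 | ⟨E, hE, h1⟩
        · exact ⟨c, List.mem_cons_self, h1⟩
        · exact ⟨E, List.mem_cons_of_mem _ hE, h1⟩
      · rcases h2 with h2 | ⟨E, hE, h2⟩
        · exact .inl h2
        · exact .inr ⟨E, List.mem_cons_of_mem _ hE, h2⟩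

lemma reassign_pairwise {n : ℕ} : ∀ {ρ : List Entry} {v : ℕ},
    (ρ.Pairwise fun E F => F.1 < E.1 ∧ E.2.1 < F.2.1) → (∀ E ∈ ρ, E.1 < v ∧ E.2.1 < n) →
    (reassign n v ρ).Pairwise fun r r' => r'.1 < r.1 ∧ r.2 < r'.2
  | [], v, _, _ => List.pairwise_singleton _ _
  | c :: t, v, h, hv => by
    rw [List.pairwise_cons] at h
    refine List.pairwise_cons.2 ⟨fun r hr => ?_, reassign_pairwise h.2 fun E hE =>
      ⟨(h.1 E hE).1, (hv E (List.mem_cons_of_mem _ hE)).2⟩⟩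
    have hc := hv c List.mem_cons_self
    obtain ⟨h1, h2⟩ := mem_reassign hr
    dsimp only
    constructor
    · rcases h1 with h1 | ⟨E, hE, h1⟩
      · omega
      · have := (h.1 E hE).1
        omega
    · rcases h2 with h2 | ⟨E, hE, h2⟩
      · omega
      · have := (h.1 E hE).2
        omega

/-- The era given to r is that of the next record, whose requirement is still smaller than that of
x, so the hypothesis on this record applies. The last one receives n. -/
lemma lt_era_of_mem_reassign {n : ℕ} {x : Entry} (hx : x.2.1 < n) {r : ℕ × ℕ} :
    ∀ {ρ : List Entry} {v : ℕ}, (ρ.Pairwise fun E F => F.1 < E.1) →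
    (∀ E ∈ ρ, E.1 < v ∧ (E.1 < x.1 → x.2.1 < E.2.1)) → r ∈ reassign n v ρ → r.1 < x.1 →
    x.2.1 < r.2
  | [], v, _, _, hr => by
    rw [reassign, List.mem_singleton] at hr
    subst hr
    exact fun _ => hx
  | c :: t, v, h, hv, hr => by
    rw [List.pairwise_cons] at h
    rw [reassign, List.mem_cons] at hr
    have hc := hv c List.mem_cons_self
    rcases hr with rfl | hr
    · dsimp only
      exact fun h' => hc.2 (by omega)
    · exact lt_era_of_mem_reassign hx h.2 (fun E hE =>
        ⟨h.1 E hE, (hv E (List.mem_cons_of_mem _ hE)).2⟩) hr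

/-- A module that is cut off is built again, after modules of smaller width. -/
lemma reassign_split {n : ℕ} {w : Entry} {B : List Entry} : ∀ {A : List Entry} {v : ℕ},
    ((A ++ w :: B).Pairwise fun E F => F.1 < E.1 ∧ E.2.1 < F.2.1) →
    (∀ E ∈ A ++ w :: B, E.1 < v ∧ E.2.1 < n) →
    ∃ A' N B', reassign n v (A ++ w :: B) = A' ++ (w.1, N) :: B' ∧ w.2.1 < N ∧
      ∀ r ∈ A', w.1 < r.1 ∧ r.2 ≤ w.2.1
  | [], v, h, hv => by
    rw [List.nil_append, List.pairwise_cons] at h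
    have hw := hv w List.mem_cons_self
    have : ∃ N B', reassign n w.1 B = (w.1, N) :: B' ∧ w.2.1 < N := by
      cases B with
      | nil => exact ⟨_, _, rfl, hw.2⟩
      | cons b B => exact ⟨_, _, rfl, (h.1 b List.mem_cons_self).2⟩
    obtain ⟨N, B', e, hN⟩ := this
    refine ⟨[(v, w.2.1)], N, B', ?_, hN, ?_⟩
    · rw [List.nil_append, reassign, e]
      rfl
    · intro r hr
      rw [List.mem_singleton.1 hr]
      exact ⟨hw.1, Nat.le_refl _⟩
  | a :: A, v, h, hv => by
    rw [List.cons_append, List.pairwise_cons] at h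
    obtain ⟨A', N, B', e, hN, hA⟩ := reassign_split (n := n) (v := a.1) h.2 fun E hE =>
      ⟨(h.1 E hE).1, (hv E (List.mem_cons_of_mem _ hE)).2⟩
    refine ⟨(v, a.2.1) :: A', N, B', ?_, hN, ?_⟩
    · rw [List.cons_append, reassign, e]
      rfl
    · intro r hr
      rcases List.mem_cons.1 hr with rfl | hr
      · have h1 := h.1 w (by simp)
        exact ⟨(hv w (by simp)).1, h1.2.le⟩
      · exact hA r hr

lemma foldl_push_stack : ∀ (L : List (ℕ × ℕ)) (X : State), ∃ K : List Entry,
    (L.foldl push X).2.2 = X.2.2 ++ K ∧ K.map (fun E => (E.1, E.2.1)) = L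
  | [], X => ⟨[], by simp, rfl⟩
  | r :: L, X => by
    obtain ⟨K, h1, h2⟩ := foldl_push_stack L (push X r)
    refine ⟨(r.1, r.2, X.1.length) :: K, ?_, ?_⟩
    · rw [List.foldl_cons, h1]
      simp [push]
    · rw [List.map_cons, h2]

lemma le_length_foldl (L : List (ℕ × ℕ)) (X : State) : X.1.length ≤ (L.foldl push X).1.length :=
  (prefix_foldl L X).length_le

/-- The requirements and eras of the records of a part of the stack. -/
lemma Tidy.records {n : ℕ} {σ t : List Entry} {c : Entry} (h : Tidy n (σ ++ c :: t)) :
    ((records (c :: t)).Pairwise fun E F => F.1 < E.1 ∧ E.2.1 < F.2.1) ∧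
    ∀ E ∈ records (c :: t), E.1 < newReq σ (records (c :: t)) ∧ E.1 + 2 ≤ E.2.1 ∧ E.2.1 < n ∧
      Free E.1 σ ∧ ∀ x ∈ σ, E.1 < x.1 → x.2.1 < E.2.1 := by
  have hsub := (records_sublist (c :: t)).subset
  have hrise := List.pairwise_append.1 h.rise
  refine ⟨?_, fun E hE => ⟨?_, ?_, ?_, ?_, fun x hx => hrise.2.2 x hx E (hsub hE)⟩⟩
  · refine (records_sorted _).imp₂ (S := fun E F => F.1 < E.1 → E.2.1 < F.2.1) ?_
      (hrise.2.1.sublist (records_sublist _))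
    exact fun E F h1 h2 => ⟨h1, h2 h1⟩
  · have h1 : E.1 ≤ c.1 := by
      have := records_sorted (c :: t)
      rw [records_cons] at this hE
      rcases List.mem_cons.1 hE with rfl | hE
      · exact Nat.le_refl _
      · exact ((List.pairwise_cons.1 this).1 E hE).le
    rw [newReq, head?_records]
    exact lt_max_of_lt_right (Nat.lt_succ_of_le h1)
  · exact h.add_two_le E (List.mem_append_right _ (hsub hE))
  · exact h.era_lt E (List.mem_append_right _ (hsub hE))
  · obtain ⟨A, B, e, hA⟩ := mem_records.1 hE
    refine Free.of_append hA (h.free (σ ++ A) E ?_)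
    rw [e]
    exact ⟨B, by simp⟩

lemma Tidy.of_foldl_todo {X : State} {σ ρ : List Entry} (l : ℕ) (h : Tidy X.1.length σ)
    (hp : ρ.Pairwise fun E F => F.1 < E.1 ∧ E.2.1 < F.2.1)
    (hρ : ∀ E ∈ ρ, E.1 < newReq σ ρ ∧ E.1 + 2 ≤ E.2.1 ∧ E.2.1 < X.1.length ∧
      Free E.1 σ ∧ ∀ x ∈ σ, E.1 < x.1 → x.2.1 < E.2.1) :
    Tidy ((todo X.1.length σ ρ).foldl push (X.1, l, σ)).1.length
      ((todo X.1.length σ ρ).foldl push (X.1, l, σ)).2.2 := by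
  refine Tidy.of_foldl h ((reassign_pairwise hp fun E hE => ?_).filter _) fun r hr => ?_
  · have := hρ E hE
    omega
  · rw [todo, List.mem_filter, decide_eq_true_eq] at hr
    obtain ⟨h1, h2⟩ := mem_reassign hr.1
    refine ⟨hr.2, ?_, fun x hx => ?_, ?_⟩
    · dsimp only
      rcases h2 with h2 | ⟨E, hE, h2⟩
      · exact h2.le
      · have := hρ E hE
        omega
    · refine lt_era_of_mem_reassign ?_ (hp.imp fun h => h.1) (fun E hE => ?_) hr.1
      · have := h.era_lt x hx
        omega
      · exact ⟨(hρ E hE).1, (hρ E hE).2.2.2.2 x hx⟩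
    · rcases h1 with h1 | ⟨E, hE, h1⟩
      · rw [h1]
        exact free_of_getLast? (le_max_left _ _)
      · rw [h1]
        exact (hρ E hE).2.2.2.1

lemma Tidy.of_step {R : ℕ → Bool} {X : State} (h : Tidy X.1.length X.2.2) :
    Tidy (step R X).1.length (step R X).2.2 := by
  rcases step_cases R X with h' | ⟨σ, c, t, h1, -, h'⟩ <;> rw [h']
  · exact Tidy.of_foldl_todo X.2.1 h .nil (by simp)
  · rw [h1] at h
    exact Tidy.of_foldl_todo _ (h.mono (Nat.le_refl _) (List.prefix_append _ _)) h.records.1 h.records.2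

/-! ### The stages and the tree in the limit -/

variable (R : ℕ → Bool)

lemma tidy_stage : ∀ s, Tidy (stage R s).1.length (stage R s).2.2
  | 0 => ⟨by simp [stage], by simp [stage], by simp [stage], by simp [stage]⟩
  | s + 1 => (tidy_stage s).of_step

/-- Requirements on the stack stay far enough below n for the new module to pass the filter. -/
lemma todo_nil {n : ℕ} {σ : List Entry} (h : Tidy n σ) :
    todo n σ [] = [(σ.getLast?.elim 0 fun c => c.1 + 1, n + 2)] := by
  have : σ.getLast?.elim 0 (fun c => c.1 + 1) ≤ n := by
    cases e : σ.getLast? with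
    | none => simp
    | some c =>
      have hc := List.mem_of_getLast? e
      have h1 := h.add_two_le c hc
      have h2 := h.era_lt c hc
      simp only [Option.elim]
      omega
  simp only [todo, reassign, newReq, List.head?_nil, Option.elim_none, Nat.max_zero]
  rw [List.filter_cons_of_pos (by simpa using this), List.filter_nil]

/-- Cut-off modules are built again, after modules of smaller width. -/
lemma todo_split {n : ℕ} {σ t A B : List Entry} {c w : Entry} (h : Tidy n (σ ++ c :: t))
    (hw : records (c :: t) = A ++ w :: B) : ∃ A' N B',
      todo n σ (records (c :: t)) = A' ++ (w.1, N) :: B' ∧ w.2.1 < N ∧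
      ∀ r ∈ A', w.1 < r.1 ∧ r.1 + 2 ≤ r.2 ∧ r.2 ≤ w.2.1 := by
  obtain ⟨h1, h2⟩ := h.records
  rw [hw] at h1
  obtain ⟨A', N, B', e, hN, hA⟩ := reassign_split (n := n + 2) (v := newReq σ (records (c :: t))) h1
    fun E hE => by have := h2 E (hw ▸ hE); omega
  refine ⟨A'.filter fun r => r.1 + 2 ≤ r.2, N, B'.filter fun r => r.1 + 2 ≤ r.2, ?_, hN,
    fun r hr => ?_⟩
  · rw [← hw] at e
    rw [todo, e, List.filter_append, List.filter_cons_of_pos]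
    have := h2 w (by rw [hw]; simp)
    simp only [decide_eq_true_eq]
    omega
  · rw [List.mem_filter, decide_eq_true_eq] at hr
    exact ⟨(hA r hr.1).1, hr.2, (hA r hr.1).2⟩

/-- Every step builds a module: after a cut, at least one with the requirement of c. -/
lemma length_stage_lt (s : ℕ) : (stage R s).1.length < (stage R (s + 1)).1.length := by
  have hT := tidy_stage R s
  have key : ∀ (L : List (ℕ × ℕ)) (X : State), L ≠ [] → X.1.length < (L.foldl push X).1.length := by
    intro L X hL
    cases L with
    | nil => exact absurd rfl hL
    | cons r L =>
      refine lt_of_lt_of_le ?_ (le_length_foldl L (push X r))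
      rw [length_push]
      omega
  rw [stage]
  rcases step_cases R (stage R s) with h' | ⟨σ, c, t, h1, -, h'⟩ <;> rw [h']
  · exact key _ _ (by rw [todo_nil hT]; simp)
  · rw [h1] at hT
    refine key _ ((stage R s).1, 2 * c.2.2, σ) ?_
    obtain ⟨A', N, B', e, -⟩ := todo_split (A := []) hT (records_cons c t)
    rw [e]
    simp

lemma lt_length_stage : ∀ s, s < (stage R s).1.length
  | 0 => by simp [stage]
  | s + 1 => by
    have := lt_length_stage s
    have := length_stage_lt R s
    omega

lemma prefix_stage {s t : ℕ} (h : s ≤ t) : (stage R s).1 <+: (stage R t).1 := by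
  induction t, h using Nat.le_induction with
  | base => exact List.prefix_refl _
  | succ t _ ih => exact ih.trans (prefix_step R _)

lemma getD_of_prefix {l k : List ℕ} (h : l <+: k) {x : ℕ} (hx : x < l.length) :
    k.getD x 0 = l.getD x 0 := by
  obtain ⟨t, rfl⟩ := h
  exact List.getD_append _ _ _ _ hx

lemma agrees_stage (s : ℕ) : Agrees (parent R) (stage R s).1 := by
  intro x hx
  rw [parent]
  rcases Nat.le_total s x with h | h
  · exact getD_of_prefix (prefix_stage R h) hx
  · exact (getD_of_prefix (prefix_stage R h) (lt_length_stage R x)).symm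

lemma valid_stage : ∀ s, Valid (parent R) (stage R s)
  | 0 => by
    refine ⟨by simp [stage], rfl, by simp [stage], ?_, ?_, by simp [stage], by simp [stage],
      by simp [stage], by simp [stage]⟩
    · intro x h0 h1
      simp [stage] at h1
      omega
    · intro y h0 h1
      simp [stage] at h1
      omega
  | s + 1 => (valid_stage s).of_step (agrees_stage R (s + 1))

lemma isParent_parent : IsParent (parent R) :=
  ⟨(valid_stage R 0).zero, fun x h => (valid_stage R x).parent_lt h (lt_length_stage R x)⟩

lemma isCovered_parent : IsCovered (parent R) :=
  fun y hy => (valid_stage R y).cover y hy (lt_length_stage R y)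

lemma IsParent.reaches_iff {p : ℕ → ℕ} (hp : IsParent p) {ps : List ℕ} (h : Agrees p ps) {x y : ℕ}
    (hx : x < ps.length) : Reaches ps x y ↔ le p x y := by
  have key : ∀ k, (fun z => ps.getD z 0)^[k] x = p^[k] x := by
    intro k
    induction k with
    | zero => rfl
    | succ k ih =>
      rw [Function.iterate_succ_apply', Function.iterate_succ_apply', ih, h _
        ((hp.iterate_le k x).trans_lt hx)]
  constructor
  · rintro ⟨k, -, e⟩
    exact ⟨k, by rw [← key, e]⟩
  · intro hle
    obtain ⟨k, hk, e⟩ := hp.exists_iterate_le hle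
    exact ⟨k, hk, by rw [key, e]⟩

/-! ### Two successive commitments -/

section Commitment

variable {p : ℕ → ℕ} {S : ℕ → ℕ → Prop} {n d n' d' : ℕ} {g g' : ℕ → ℕ}

lemma IsCommitment.injOn (hp : IsParent p) (hS : IsPosetTree S) (hg : IsCommitment p S n d g) :
    Set.InjOn g {i | i < d + 1} := by
  intro i hi j hj h
  have h1 : S (g i) (g j) := by rw [h]; exact hS.1 _
  have h2 : S (g j) (g i) := by rw [h]; exact hS.1 _
  exact hp.antisymm ((hg.iff i hi j hj).2 h1) ((hg.iff j hj i hi).2 h2)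

open Classical in
-- An element up to n that is not below g c must be g i with i < c. The tree has only n - c elements
-- from c on, so S is ahead by one.
lemma IsCommitment.card_below (hS : IsPosetTree S) (hg : IsCommitment p S n d g) {c : ℕ}
    (hcd : c ≤ d) (hbelow : ∀ x ≤ d, c ≤ x → le p x c) :
    n + 1 ≤ ((Finset.range (n + 1)).filter fun s => S s (g c)).card + c := by
  have hsub : Finset.range (n + 1) ⊆
      ((Finset.range (n + 1)).filter fun s => S s (g c)) ∪ (Finset.range c).image g := by
    intro s hs
    rw [Finset.mem_union, Finset.mem_filter, Finset.mem_image]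
    by_cases h : S s (g c)
    · exact .inl ⟨hs, h⟩
    · right
      rcases hg.rest s (Finset.mem_range.1 hs) with ⟨i, hi, rfl⟩ | h'
      · refine ⟨i, Finset.mem_range.2 ?_, rfl⟩
        by_contra hc
        exact h ((hg.iff i hi c (by omega)).1 (hbelow i (by omega) (by omega)))
      · exact absurd (hS.2.2.1 _ _ _ h' ((hg.iff d (by omega) c (by omega)).1
          (hbelow d (Nat.le_refl d) hcd))) h
  have h1 := (Finset.card_le_card hsub).trans (Finset.card_union_le _ _)
  have h2 := Finset.card_image_le (s := Finset.range c) (f := g)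
  rw [Finset.card_range] at h1 h2
  omega

open Classical in
-- Everything new is below the leaf 2m, so the number of elements below the fork is frozen and too
-- small for its former image. The cases go by the place of t, the element whose new image is the
-- old image of the fork.
lemma IsCommitment.fork_le_leaf (hp : IsParent p) (hS : IsPosetTree S) (hg : IsCommitment p S n d g)
    (hg' : IsCommitment p S n' d' g') {m Q : ℕ} (b : IsBlock p m Q) (hmn : 4 * m + 6 + 2 * Q ≤ n)
    (hbelow : ∀ x < n, 2 * m + 1 ≤ x → le p x (2 * m + 1)) (hmd : 2 * m + 1 ≤ d) (hdn : d < n)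
    (hnd : n ≤ d') (hnn : n ≤ n') (hnew : ∀ x, n ≤ x → x ≤ d' → le p x (2 * m)) :
    S (g (2 * m + 1)) (g' (2 * m)) := by
  have hm := b.pos
  have hleafstem : ∀ {t}, le p (2 * m) t → ¬ le p t (2 * m) → le p (2 * m - 1) t := by
    intro t h1 h2
    have := le_parent_of_ne h1 fun h => h2 (h ▸ le_refl _)
    rwa [b.parent_leaf] at this
  have hgc := hg.le_size (2 * m + 1) (by omega)
  rcases hg'.rest (g (2 * m + 1)) (by omega) with ⟨t, ht, e⟩ | h
  swap
  · exact hS.2.2.1 _ _ _ h ((hg'.iff d' (by omega) (2 * m) (by omega)).1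
      (hnew d' hnd (Nat.le_refl d')))
  by_cases h1 : le p t (2 * m)
  · rw [← e]
    exact (hg'.iff t ht (2 * m) (by omega)).1 h1
  exfalso
  -- An element strictly above the leaf is strictly above the fork. Counting upwards, the old image
  -- of the fork has too many elements above it to be the image of t.
  by_cases h2 : le p (2 * m) t
  · have h3 := hleafstem h2 h1
    have h4 := hp.ge h3
    have hct : le p (2 * m + 1) t := le_trans b.fork_le h3
    have hlt : ((Finset.range (d' + 1)).filter fun x => le p t x).card <
        ((Finset.range (d + 1)).filter fun x => le p (2 * m + 1) x).card := by
      refine Finset.card_lt_card (Finset.ssubset_iff_subset_ne.2 ⟨fun x hx => ?_, fun h => ?_⟩)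
      · rw [Finset.mem_filter, Finset.mem_range] at hx ⊢
        have := le_trans hct hx.2
        exact ⟨by have := hp.ge this; omega, this⟩
      · have : 2 * m + 1 ∈ (Finset.range (d + 1)).filter fun x => le p (2 * m + 1) x :=
          Finset.mem_filter.2 ⟨Finset.mem_range.2 (by omega), le_refl _⟩
        rw [← h, Finset.mem_filter] at this
        have := hp.ge this.2
        omega
    have hsub : ((Finset.range (d + 1)).filter fun x => le p (2 * m + 1) x).image g ⊆
        ((Finset.range (d' + 1)).filter fun x => le p t x).image g' := by
      intro s hs
      obtain ⟨x, hx, rfl⟩ := Finset.mem_image.1 hs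
      rw [Finset.mem_filter, Finset.mem_range] at hx
      have hS1 : S (g' t) (g x) := e ▸ (hg.iff _ (by omega) x hx.1).1 hx.2
      have hgx := hg.le_size x hx.1
      rcases hg'.rest (g x) (by omega) with ⟨x', hx', e'⟩ | h'
      · refine Finset.mem_image.2 ⟨x', Finset.mem_filter.2 ⟨Finset.mem_range.2 hx', ?_⟩, e'⟩
        exact (hg'.iff t ht x' hx').2 (e' ▸ hS1)
      · have := hp.ge ((hg'.iff t ht d' (by omega)).2 (hS.2.2.1 _ _ _ hS1 h'))
        omega
    have hinj : Set.InjOn g ((Finset.range (d + 1)).filter fun x => le p (2 * m + 1) x) :=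
      (hg.injOn hp hS).mono fun x hx => by
        rw [Finset.mem_coe, Finset.mem_filter, Finset.mem_range] at hx
        exact hx.1
    have h5 := Finset.card_le_card hsub
    rw [Finset.card_image_of_injOn hinj] at h5
    have := h5.trans Finset.card_image_le
    omega
  -- Now t and the leaf are incomparable, so no new element is below t, and at least n - 2m elements
  -- of S below its image must come from old elements of the tree.
  · have hcard := hg.card_below hS hmd fun x hx hx' => hbelow x (by omega) hx'
    have hsub : ((Finset.range (n + 1)).filter fun s => S s (g (2 * m + 1))) ⊆
        ((Finset.range n).filter fun x => le p x t).image g' := by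
      intro s hs
      rw [Finset.mem_filter, Finset.mem_range, ← e] at hs
      rcases hg'.rest s (by omega) with ⟨x, hx, rfl⟩ | h'
      · have hxt := (hg'.iff x hx t ht).2 hs.2
        refine Finset.mem_image.2 ⟨x, Finset.mem_filter.2 ⟨Finset.mem_range.2 ?_, hxt⟩, rfl⟩
        by_contra hxn
        rcases le_linear hxt (hnew x (by omega) (by omega)) with h | h
        · exact h1 h
        · exact h2 h
      · exfalso
        have hda := hnew d' hnd (Nat.le_refl d')
        rcases (hS.2.2.2.2 s).2 _ _ hs.2 h' with h | h
        · exact h1 (le_trans ((hg'.iff t ht d' (by omega)).2 h) hda)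
        · rcases le_linear ((hg'.iff d' (by omega) t ht).2 h) hda with h | h
          · exact h1 h
          · exact h2 h
    have hle := (Finset.card_le_card hsub).trans Finset.card_image_le
    by_cases h3 : le p t (2 * m + 1)
    -- At or below the fork there are at most n - 2m - 1 old elements.
    · have : ((Finset.range n).filter fun x => le p x t) ⊆ Finset.Ico (2 * m + 1) n := by
        intro x hx
        rw [Finset.mem_filter, Finset.mem_range] at hx
        exact Finset.mem_Ico.2 ⟨hp.ge (le_trans hx.2 h3), hx.1⟩
      have := Finset.card_le_card this
      rw [Nat.card_Ico] at this
      omega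
    -- Away from the fork only elements older than it qualify. The longer branch makes n at least 4m
    -- + 6, so n - 2m exceeds their number.
    · have : ((Finset.range n).filter fun x => le p x t) ⊆ Finset.range (2 * m + 1) := by
        intro x hx
        rw [Finset.mem_filter, Finset.mem_range] at hx
        rw [Finset.mem_range]
        by_contra hxc
        rcases le_linear hx.2 (hbelow x hx.1 (by omega)) with h | h
        · exact h3 h
        · have h4 := le_parent_of_ne h fun h => h3 (h ▸ le_refl _)
          rw [b.fork] at h4
          refine h2 (le_trans ?_ h4)
          have := le_parent (p := p) (2 * m)
          rwa [b.parent_leaf] at this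
      have := Finset.card_le_card this
      rw [Finset.card_range] at this
      omega

open Classical in
/-- Elements which are strictly below the fork in one commitment are in the longer branch or the
tooth, or above the fork, in the next one. -/
lemma IsCommitment.below_of_next (hp : IsParent p) (hS : IsPosetTree S)
    (hg' : IsCommitment p S n' d' g') {a m' Q' q y u : ℕ} (hyn : y ≤ n) (huy : S y u) (hne : y ≠ u)
    (hua : S u (g' a))
    (hcard : q ≤ ((Finset.range (n + 1)).filter fun s => S s y).card)
    (b' : IsBlock p m' Q') (hd' : d' = 2 * m' + 2 + Q') (had : a ≤ d') (hnn : n ≤ n')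
    (hleaf : ∀ x < n, le p x a → x = a)
    (hteeth : ∀ x, n ≤ x → x ≤ 2 * m' + 1 → le p (2 * m' + 1) x ∨
      ∃ T : Finset ℕ, T.card < q ∧ ∀ u ≤ d', le p u x → u ∈ T) :
    (S y (g' (2 * m' + 2)) ∨ S y (g' d')) ∨ S (g' (2 * m' + 1)) y := by
  rcases hg'.rest y (by omega) with ⟨x, hx, rfl⟩ | h
  swap
  · exact .inl (.inr h)
  have hxa : le p x a := (hg'.iff x hx a (by omega)).2 (hS.2.2.1 _ _ _ huy hua)
  -- The old tree has nothing strictly below the leaf a, so x is new.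
  have hxn : n ≤ x := by
    by_contra hxn
    have := hleaf x (by omega) hxa
    subst this
    exact hne (hS.2.1 _ _ huy hua)
  rcases Nat.lt_or_ge (2 * m' + 1) x with h | h
  · left
    rcases Nat.lt_or_ge x d' with h1 | h1
    · exact .inl ((hg'.iff x hx _ (by omega)).1 (b'.le_tooth (by omega) (by omega)))
    · right
      rw [show x = d' by omega]
      exact hS.1 _
  · right
    by_cases hspine : le p (2 * m' + 1) x
    · exact (hg'.iff _ (by omega) x hx).1 hspine
    exfalso
    -- A side branch with fewer than q elements cannot accommodate the q elements of S below y.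
    obtain ⟨T, hT, hT'⟩ := (hteeth x hxn h).resolve_left hspine
    have hsub : ((Finset.range (n + 1)).filter fun s => S s (g' x)) ⊆ T.image g' := by
      intro s hs
      rw [Finset.mem_filter, Finset.mem_range] at hs
      rcases hg'.rest s (by omega) with ⟨v, hv, rfl⟩ | h'
      · exact Finset.mem_image_of_mem _ (hT' v (by omega) ((hg'.iff v hv x hx).2 hs.2))
      · exfalso
        rcases (hS.2.2.2.2 s).2 _ _ hs.2 h' with h1 | h1
        · have := hp.ge ((hg'.iff x hx d' (by omega)).2 h1)
          omega
        · have h2 := (hg'.iff d' (by omega) x hx).2 h1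
          have h3 : le p d' (2 * m' + 1) := hd' ▸ b'.side_le
          rcases le_linear h2 h3 with h4 | h4
          · have := hp.ge h4
            rw [show x = 2 * m' + 1 by omega] at hspine
            exact hspine (le_refl _)
          · exact hspine h4
    have := (Finset.card_le_card hsub).trans Finset.card_image_le
    omega

open Classical in
/-- Of two successive commitments, the tooth and the longer branch of the first go below those of
the second. -/
theorem IsCommitment.descend (hp : IsParent p) (hS : IsPosetTree S) {mw Qw : ℕ}
    (bw : IsBlock p mw Qw) (hw : 4 * mw + 6 + 2 * Qw ≤ n) (hQ : 1 ≤ Qw)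
    (hbw : ∀ x < n, 2 * mw + 2 + Qw ≤ x → le p x (2 * mw + 2 + Qw))
    (hg : IsCommitment p S n (2 * mw + 2 + Qw) g) {m Q : ℕ} (b : IsBlock p m Q)
    (hmn : 4 * m + 6 + 2 * Q ≤ n) (hbelow : ∀ x < n, 2 * m + 1 ≤ x → le p x (2 * m + 1))
    (hleaf : ∀ x < n, le p x (2 * m) → x = 2 * m) (hmw : m ≤ mw)
    {m' Q' : ℕ} (b' : IsBlock p m' Q') (hnm : n ≤ m') (hnn : n ≤ n')
    (hg' : IsCommitment p S n' (2 * m' + 2 + Q') g')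
    (hnew : ∀ x, n ≤ x → x ≤ 2 * m' + 2 + Q' → le p x (2 * m))
    (hteeth : ∀ x, n ≤ x → x ≤ 2 * m' + 1 → le p (2 * m' + 1) x ∨
      ∃ T : Finset ℕ, T.card < Qw ∧ ∀ u ≤ 2 * m' + 2 + Q', le p u x → u ∈ T) :
    ∀ i, i = 2 * mw + 2 ∨ i = 2 * mw + 2 + Qw →
      S (g i) (g' (2 * m' + 2)) ∨ S (g i) (g' (2 * m' + 2 + Q')) := by
  have hstep := hg.fork_le_leaf hp hS hg' b hmn hbelow (by omega) (by omega) (by omega) hnn hnew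
  have hinj := hg.injOn hp hS
  have key : ∀ i, i = 2 * mw + 2 ∨ i = 2 * mw + 2 + Qw →
      (S (g i) (g' (2 * m' + 2)) ∨ S (g i) (g' (2 * m' + 2 + Q'))) ∨
        S (g' (2 * m' + 1)) (g i) := by
    intro i hi
    refine hg'.below_of_next hp hS (u := g (2 * m + 1)) (a := 2 * m) (q := Qw) (n := n) ?_ ?_ ?_
      hstep ?_ b' rfl (by omega) hnn hleaf hteeth
    · have := hg.le_size i (by omega)
      omega
    · exact (hg.iff i (by omega) _ (by omega)).1 (hbelow i (by omega) (by omega))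
    · intro h
      have := hinj (show i < _ by omega) (show 2 * m + 1 < _ by omega) h
      omega
    -- The tooth itself has Qw elements. For the longer branch, `card_below` leaves at least n + 1 -
    -- (2mw + 2 + Qw), which is enough as n ≥ 4mw + 6 + 2Qw.
    · rcases hi with rfl | rfl
      · have hsub : (Finset.Ico (2 * mw + 2) (2 * mw + 2 + Qw)).image g ⊆
            (Finset.range (n + 1)).filter fun s => S s (g (2 * mw + 2)) := by
          intro s hs
          obtain ⟨x, hx, rfl⟩ := Finset.mem_image.1 hs
          rw [Finset.mem_Ico] at hx
          exact Finset.mem_filter.2 ⟨Finset.mem_range.2 (hg.le_size x (by omega)),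
            (hg.iff x (by omega) _ (by omega)).1 (bw.le_tooth hx.1 hx.2)⟩
        have := Finset.card_le_card hsub
        rw [Finset.card_image_of_injOn (hinj.mono fun x hx => by
          rw [Finset.mem_coe, Finset.mem_Ico] at hx
          exact hx.2.trans (Nat.lt_succ_self _)), Nat.card_Ico] at this
        omega
      · have := hg.card_below hS (Nat.le_refl _) fun x hx hx' => hbw x (by omega) hx'
        omega
  have hinc1 : ¬ S (g (2 * mw + 2)) (g (2 * mw + 2 + Qw)) := fun h => by
    have := hp.ge ((hg.iff _ (by omega) _ (by omega)).2 h)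
    omega
  have hinc2 : ¬ S (g (2 * mw + 2 + Qw)) (g (2 * mw + 2)) := fun h => by
    have h1 := le_parent_of_ne ((hg.iff _ (by omega) _ (by omega)).2 h) (by omega)
    rw [bw.side] at h1
    have := hp.ge h1
    omega
  have htooth : S (g' (2 * m' + 2)) (g' (2 * m' + 1)) := by
    refine (hg'.iff _ (by omega) _ (by omega)).1 (b'.le_fork (by omega) (by omega))
  have hside : S (g' (2 * m' + 2 + Q')) (g' (2 * m' + 1)) :=
    (hg'.iff _ (by omega) _ (by omega)).1 b'.side_le
  -- An image at or above the new fork is comparable to the other image, be that one below the fork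
  -- or above it. As the two are incomparable, neither is at or above the fork.
  have hcomp : ∀ {y z}, S (g' (2 * m' + 1)) y →
      ((S z (g' (2 * m' + 2)) ∨ S z (g' (2 * m' + 2 + Q'))) ∨ S (g' (2 * m' + 1)) z) →
      S y z ∨ S z y := by
    rintro y z hy ((hz | hz) | hz)
    · exact .inr (hS.2.2.1 _ _ _ hz (hS.2.2.1 _ _ _ htooth hy))
    · exact .inr (hS.2.2.1 _ _ _ hz (hS.2.2.1 _ _ _ hside hy))
    · exact (hS.2.2.2.2 _).2 _ _ hy hz
  intro i hi
  refine (key i hi).resolve_right fun h => ?_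
  rcases hi with rfl | rfl
  · rcases hcomp h (key _ (.inr rfl)) with h' | h'
    · exact hinc1 h'
    · exact hinc2 h'
  · rcases hcomp h (key _ (.inl rfl)) with h' | h'
    · exact hinc2 h'
    · exact hinc1 h'

end Commitment

/-! ### How a module is replaced -/

variable {p : ℕ → ℕ}

lemma Valid.le_leaf_of_foldl {L : List (ℕ × ℕ)} : ∀ {X : State}, Valid p X →
    Agrees p (L.foldl push X).1 → ∀ x, X.1.length ≤ x → x < (L.foldl push X).1.length →
    le p x X.2.1 := by
  induction L with
  | nil => exact fun _ _ x h1 h2 => absurd h2 (Nat.not_lt.2 h1)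
  | cons r L ih =>
    intro X h ha x h1 h2
    have ha' := ha.of_prefix (prefix_foldl L (push X r))
    obtain ⟨b, h0⟩ := h.isBlock_push ha'
    have hblock : ∀ x, X.1.length ≤ x → x < (push X r).1.length → le p x X.2.1 := by
      intro x h1 h2
      rw [length_push] at h2
      exact le_trans (b.le_start h1 (by omega)) (h0 ▸ le_parent _)
    rcases Nat.lt_or_ge x (push X r).1.length with h3 | h3
    · exact hblock x h1 h3
    · have h4 := (h.of_push ha').leaf_lt
      refine le_trans (ih (h.of_push ha') ha x h3 h2) (hblock _ ?_ h4)
      simp only [push]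
      omega

/-- Off the path to the last fork there are only the leaves and teeth of the modules. The teeth are
shorter than q by assumption; for the leaves q must be at least 2. -/
lemma Valid.spine_or_tooth (hp : IsParent p) {q : ℕ} (hq : 2 ≤ q) {r : ℕ × ℕ}
    {L : List (ℕ × ℕ)} : ∀ {X : State}, Valid p X → (∀ s ∈ L, s.2 - s.1 < q) →
    Agrees p (push (L.foldl push X) r).1 → ∀ x, X.1.length ≤ x →
    x ≤ 2 * (L.foldl push X).1.length + 1 → le p (2 * (L.foldl push X).1.length + 1) x ∨
      ∃ T : Finset ℕ, T.card < q ∧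
        ∀ u ≤ 2 * (L.foldl push X).1.length + 2 + (r.2 - r.1), le p u x → u ∈ T := by
  induction L with
  | nil =>
    intro X h _ ha x h1 h2
    rw [List.foldl_nil] at *
    obtain ⟨b, -⟩ := h.isBlock_push ha
    rcases Nat.lt_trichotomy x (2 * X.1.length) with h3 | rfl | h3
    · exact .inl (le_trans b.fork_le (b.le_stem h1 h3))
    · refine .inr ⟨{2 * X.1.length}, by rw [Finset.card_singleton]; omega, fun u hu hle => ?_⟩
      exact Finset.mem_singleton.2 (b.eq_leaf hp (by omega) hle)
    · rw [show x = 2 * X.1.length + 1 by omega]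
      exact .inl (le_refl _)
  | cons a L ih =>
    intro X h hL ha x h1 h2
    have hpre : (push X a).1 <+: (push (L.foldl push (push X a)) r).1 :=
      (prefix_foldl L _).trans (prefix_push _ _)
    have ha' := ha.of_prefix hpre
    have hv := h.of_push ha'
    obtain ⟨b, -⟩ := h.isBlock_push ha'
    rcases Nat.lt_or_ge x (push X a).1.length with h3 | h3
    swap
    · exact ih hv (fun s hs => hL s (List.mem_cons_of_mem _ hs)) ha x h3 h2
    have hqa := hL a List.mem_cons_self
    have hlen := le_length_foldl L (push X a)
    have hbelow : ∀ u, (push X a).1.length ≤ u →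
        u ≤ 2 * ((a :: L).foldl push X).1.length + 2 + (r.2 - r.1) →
        le p u (4 * X.1.length + 5 + 2 * (a.2 - a.1)) := by
      intro u hu hu'
      have := hv.le_leaf_of_foldl (L := L ++ [r]) (by simpa using ha) u hu ?_
      · exact this
      · rw [List.foldl_append, List.foldl_cons, List.foldl_nil, length_push]
        rw [List.foldl_cons] at hu'
        omega
    rw [length_push] at h3 hbelow hlen
    rw [List.foldl_cons] at hbelow h2 ⊢
    have hup : ∀ u ≤ 2 * (L.foldl push (push X a)).1.length + 2 + (r.2 - r.1), le p u x →
        ¬ le p (4 * X.1.length + 5 + 2 * (a.2 - a.1)) x →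
        u < 4 * X.1.length + 6 + 2 * (a.2 - a.1) := by
      intro u hu hle hnle
      by_contra hge
      rcases le_linear hle (hbelow u (by omega) hu) with h4 | h4
      · have := hp.ge h4
        rw [show x = 4 * X.1.length + 5 + 2 * (a.2 - a.1) by omega] at hnle
        exact hnle (le_refl _)
      · exact hnle h4
    have hspine : le p (4 * X.1.length + 5 + 2 * (a.2 - a.1)) x →
        le p (2 * (L.foldl push (push X a)).1.length + 1) x := fun h' =>
      le_trans (hbelow _ (by omega) (by omega)) h'
    by_cases h4 : x = 2 * X.1.length
    · subst h4
      refine .inr ⟨{2 * X.1.length}, by rw [Finset.card_singleton]; omega, fun u hu hle => ?_⟩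
      refine Finset.mem_singleton.2 (b.eq_leaf hp (hup u hu hle fun h' => ?_) hle)
      have := b.eq_leaf hp (by omega) h'
      omega
    by_cases h5 : 2 * X.1.length + 2 ≤ x ∧ x < 2 * X.1.length + 2 + (a.2 - a.1)
    · refine .inr ⟨Finset.Ico (2 * X.1.length + 2) (2 * X.1.length + 2 + (a.2 - a.1)), ?_,
        fun u hu hle => ?_⟩
      · rw [Nat.card_Ico]
        omega
      · have h6 := b.lt_side hp h5.1 h5.2 (hup u hu hle fun h' => ?_) hle
        · have := hp.ge hle
          exact Finset.mem_Ico.2 ⟨by omega, h6⟩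
        · have := b.lt_side hp h5.1 h5.2 (by omega) h'
          omega
    · refine .inl (hspine ?_)
      rcases Nat.lt_or_ge x (2 * X.1.length) with h6 | h6
      · exact b.last_le_stem h1 h6
      rcases Nat.lt_or_ge x (2 * X.1.length + 2) with h7 | h7
      · rw [show x = 2 * X.1.length + 1 by omega]
        exact b.last_le_fork
      · exact b.last_le (by omega) h3

variable (R : ℕ → Bool)

/-- The stack after `s` steps. -/
noncomputable abbrev stack (s : ℕ) : List Entry := (stage R s).2.2

/-- The size of the tree after `s` steps. -/
noncomputable abbrev size (s : ℕ) : ℕ := (stage R s).1.length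

/-- In step `s` the stack is cut before the entry `c`, which is followed by `t`. -/
structure IsCut (s : ℕ) (σ : List Entry) (c : Entry) (t : List Entry) : Prop where
  eq : stack R s = σ ++ c :: t
  commits : ∀ E ∈ records (c :: t), Commits R (stage R s).1 E
  next : stage R (s + 1) =
    (todo (size R s) σ (records (c :: t))).foldl push ((stage R s).1, 2 * c.2.2, σ)

variable {R}

lemma IsCut.tidy {s : ℕ} {σ t : List Entry} {c : Entry} (h : IsCut R s σ c t) :
    Tidy (size R s) (σ ++ c :: t) := by
  have := tidy_stage R s
  rwa [← h.eq]

lemma Commits.isCommitment (hp : IsParent p) {ps : List ℕ} (ha : Agrees p ps) {E : Entry}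
    (hE : side E < ps.length) (h : Commits R ps E) :
    ∃ g, IsCommitment p (Rel R E.1) ps.length (side E) g := by
  obtain ⟨-, c, -, h1, h2, h3⟩ := h
  refine ⟨decodeMap c, h1, fun i hi j hj => ?_, h3⟩
  rw [← h2 i hi j hj, hp.reaches_iff ha (by omega)]

lemma side_lt_size {s : ℕ} {E : Entry} (h : E ∈ stack R s) : side E < size R s := by
  have := (valid_stage R s).bottom_lt h
  simp only [bottom, side, size] at *
  omega

/-- When a module is cut off it is replaced by a module with the same requirement, and commitments
to the new module are related to commitments to the old one. -/
lemma IsCut.exists_next {s : ℕ} {σ t A B : List Entry} {c w : Entry} (h : IsCut R s σ c t)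
    (hw : records (c :: t) = A ++ w :: B) : ∃ w' K K', w'.1 = w.1 ∧ size R s ≤ w'.2.2 ∧
      stack R (s + 1) = σ ++ K ++ w' :: K' ∧ (∀ E ∈ K, w.1 < E.1) ∧
      ∀ s' S g g', s + 1 ≤ s' → w' ∈ stack R s' → IsPosetTree S →
        IsCommitment (parent R) S (size R s) (side w) g →
        IsCommitment (parent R) S (size R s') (side w') g' →
        ∀ i, i = 2 * w.2.2 + 2 ∨ i = side w →
          S (g i) (g' (2 * w'.2.2 + 2)) ∨ S (g i) (g' (side w')) := by
  have hp := isParent_parent R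
  have hT := h.tidy
  obtain ⟨A', N, B', e, hN, hA⟩ := todo_split hT hw
  set X : State := ((stage R s).1, 2 * c.2.2, σ) with hX
  have hvs := valid_stage R s
  have hvX : Valid (parent R) X := hvs.of_cut h.eq
  have hnext := h.next
  rw [← hX, e, List.foldl_append, List.foldl_cons] at hnext
  obtain ⟨K, hK, hKA⟩ := foldl_push_stack A' X
  set X₁ := A'.foldl push X with hX₁
  set X₂ := push X₁ (w.1, N) with hX₂
  obtain ⟨K', hK', -⟩ := foldl_push_stack B' X₂
  have ha : Agrees (parent R) (stage R (s + 1)).1 := agrees_stage R (s + 1)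
  rw [hnext] at ha
  have ha₂ : Agrees (parent R) X₂.1 := ha.of_prefix (prefix_foldl B' X₂)
  have ha₁ : Agrees (parent R) X₁.1 := ha₂.of_prefix (prefix_push _ _)
  have hv₁ : Valid (parent R) X₁ := hvX.of_foldl ha₁
  obtain ⟨b', -⟩ := hv₁.isBlock_push ha₂
  have hn₁ : size R s ≤ X₁.1.length := le_length_foldl A' X
  have hrec : ∀ E ∈ records (c :: t), E ∈ stack R s := fun E hE => by
    rw [h.eq]
    exact List.mem_append_right _ ((records_sublist _).subset hE)
  have hws : w ∈ stack R s := hrec w (by rw [hw]; simp)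
  have hcs : c ∈ stack R s := by rw [h.eq]; simp
  have hw2 := (tidy_stage R s).add_two_le w hws
  refine ⟨(w.1, N, X₁.1.length), K, K', rfl, hn₁, ?_, ?_, ?_⟩
  · simp only [stack]
    rw [hnext, hK', hX₂]
    simp [push, hK, hX]
  · intro E hE
    have : (E.1, E.2.1) ∈ A' := by rw [← hKA]; exact List.mem_map_of_mem hE
    exact (hA _ this).1
  · intro s' S g g' hs' hw' hS hg hg' i hi
    have bc := hvs.block c hcs
    have bw := hvs.block w hws
    have hbc := hvs.bottom_lt hcs
    have hbw := hvs.bottom_lt hws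
    have hlec := hvs.le_bottom c hcs
    have hlew := hvs.le_bottom w hws
    simp only [bottom] at hbc hbw hlec hlew
    -- The tree resumes at the leaf of c, but the commitment is one to w. As c starts no later than
    -- w, the map g is defined on the fork of c.
    have hmw : c.2.2 ≤ w.2.2 := by
      have hmem : w ∈ c :: t := (records_sublist _).subset (by rw [hw]; simp)
      have hsort := hvs.sorted
      have heq := h.eq
      simp only [stack] at heq
      rw [heq, List.pairwise_append] at hsort
      rcases List.mem_cons.1 hmem with rfl | hmem
      · exact Nat.le_refl _
      · have := (List.pairwise_cons.1 hsort.2.1).1 w hmem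
        simp only [bottom] at this
        omega
    have hsz : size R s = (stage R s).1.length := rfl
    have hss : size R s ≤ size R s' := (prefix_stage R (by omega)).length_le
    have hside : side w = 2 * w.2.2 + 2 + width w := rfl
    have hside' : side (w.1, N, X₁.1.length) = 2 * X₁.1.length + 2 + (N - w.1) := rfl
    rw [hside] at hg hi
    rw [hside'] at hg' ⊢
    refine IsCommitment.descend hp hS bw (by omega) (by unfold width; omega) ?_ hg bc
      (by omega) ?_ ?_ hmw b' hn₁ hss hg' ?_ ?_ i hi
    · intro x hx hx'
      rcases Nat.lt_or_ge x (4 * w.2.2 + 6 + 2 * width w) with h1 | h1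
      · exact bw.le_side hx' h1
      · exact le_trans (hlew x (by omega) hx) (bw.le_side (by omega) (by omega))
    · intro x hx hx'
      rcases Nat.lt_or_ge x (4 * c.2.2 + 6 + 2 * width c) with h1 | h1
      · exact bc.le_fork hx' h1
      · exact le_trans (hlec x (by omega) hx) bc.last_le_fork
    · intro x hx hle
      rcases Nat.lt_or_ge x (4 * c.2.2 + 6 + 2 * width c) with h1 | h1
      · exact bc.eq_leaf hp h1 hle
      · exfalso
        rcases le_linear hle (hlec x (by omega) hx) with h2 | h2
        · have := hp.ge h2
          omega
        · have := bc.eq_leaf hp (by omega) h2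
          omega
    · intro x hx hx'
      have h1 := hvX.le_leaf_of_foldl (L := A' ++ [(w.1, N)]) (by simpa using ha₂) x hx ?_
      · exact h1
      · rw [List.foldl_append, List.foldl_cons, List.foldl_nil, length_push]
        change x < 4 * X₁.1.length + 6 + 2 * (N - w.1)
        omega
    · intro x hx hx'
      refine hvX.spine_or_tooth hp (by unfold width; omega) (fun r hr => ?_) ha₂ x hx hx'
      have := hA r hr
      unfold width
      omega

/-! ### Permanent parts of the stack -/

variable {R : ℕ → Bool}

/-- Either nothing is cut off the stack, or a part with committing records. -/
lemma isCut_or (R : ℕ → Bool) (s : ℕ) :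
    stage R (s + 1) = (todo (size R s) (stack R s) []).foldl push (stage R s) ∨
    ∃ σ c t, IsCut R s σ c t := by
  rcases step_cases R (stage R s) with h | ⟨σ, c, t, h1, h2, h3⟩
  · exact .inl h
  · exact .inr ⟨σ, c, t, h1, h2, h3⟩

lemma todo_pairwise {n : ℕ} {σ ρ : List Entry}
    (hp : ρ.Pairwise fun E F => F.1 < E.1 ∧ E.2.1 < F.2.1)
    (hρ : ∀ E ∈ ρ, E.1 < newReq σ ρ ∧ E.2.1 < n + 2) :
    (todo n σ ρ).Pairwise fun r r' => r'.1 < r.1 :=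
  ((reassign_pairwise hp hρ).filter _).imp fun h => h.1

/-- The new stack consists of a part of the old one and modules with decreasing requirements. -/
lemma exists_stack_succ (R : ℕ → Bool) (s : ℕ) : ∃ σ K, σ <+: stack R s ∧
    stack R (s + 1) = σ ++ K ∧ K.Pairwise (fun E F => F.1 < E.1) ∧
    (σ = stack R s ∨ ∃ c t, IsCut R s σ c t) := by
  have hT := tidy_stage R s
  rcases isCut_or R s with h | ⟨σ, c, t, h⟩
  · obtain ⟨K, h1, h2⟩ := foldl_push_stack (todo (size R s) (stack R s) []) (stage R s)
    refine ⟨stack R s, K, List.prefix_refl _, by simp only [stack, h, h1], ?_, .inl rfl⟩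
    have := todo_pairwise (n := size R s) (σ := stack R s) (ρ := []) .nil (by simp)
    rw [← h2] at this
    exact List.pairwise_map.1 this
  · obtain ⟨K, h1, h2⟩ := foldl_push_stack (todo (size R s) σ (records (c :: t)))
      ((stage R s).1, 2 * c.2.2, σ)
    refine ⟨σ, K, ⟨_, h.eq.symm⟩, by simp only [stack, h.next, h1], ?_, .inr ⟨c, t, h⟩⟩
    have := todo_pairwise (n := size R s) (σ := σ) h.tidy.records.1 fun E hE => by
      have := h.tidy.records.2 E hE
      omega
    rw [← h2] at this
    exact List.pairwise_map.1 this

lemma foldl_push_start {L : List (ℕ × ℕ)} : ∀ {X : State}, ∀ E ∈ (L.foldl push X).2.2,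
    E ∈ X.2.2 ∨ X.1.length ≤ E.2.2 := by
  induction L with
  | nil => exact fun E hE => .inl hE
  | cons r L ih =>
    intro X E hE
    rcases ih E hE with h | h
    · rcases List.mem_append.1 h with h | h
      · exact .inl h
      · rw [List.mem_singleton.1 h]
        exact .inr (Nat.le_refl _)
    · right
      rw [length_push] at h
      omega

/-- What remains on the stack was not cut off. -/
lemma IsCut.prefix_of_prefix {s : ℕ} {σ t Q : List Entry} {c : Entry} (h : IsCut R s σ c t)
    (h1 : Q <+: stack R s) (h2 : Q <+: stack R (s + 1)) : Q <+: σ := by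
  have h3 : σ <+: stack R s := ⟨_, h.eq.symm⟩
  rcases Nat.le_total Q.length σ.length with h4 | h4
  · exact List.prefix_of_prefix_length_le h1 h3 h4
  obtain ⟨U, rfl⟩ := List.prefix_of_prefix_length_le h3 h1 h4
  cases U with
  | nil => simp
  | cons u U =>
    -- Modules built in this step start at or beyond the old size, so an entry that was cut off
    -- cannot reappear.
    exfalso
    have hnodup : (stack R (s + 1)).Pairwise fun E F => bottom E < F.2.2 :=
      (valid_stage R (s + 1)).sorted
    have hnodup' : (stack R s).Pairwise fun E F => bottom E < F.2.2 := (valid_stage R s).sorted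
    have hu : u ∈ stack R (s + 1) := h2.subset (by simp)
    have hu' : u ∈ stack R s := h1.subset (by simp)
    have hσ : u ∉ σ := fun hu => by
      have := (List.pairwise_append.1 (hnodup'.sublist h1.sublist)).2.2 u hu u (by simp)
      simp only [bottom] at this
      omega
    simp only [stack, h.next] at hu
    rcases foldl_push_start u hu with h5 | h5
    · exact hσ h5
    · have := side_lt_size hu'
      simp only [side, size] at *
      omega

/-- The list `P` is at the beginning of the stack from stage `s` on. -/
def IsPermanent (R : ℕ → Bool) (s : ℕ) (P : List Entry) : Prop := ∀ t, s ≤ t → P <+: stack R t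

lemma exists_first {q : Entry → Prop} : ∀ {l : List Entry}, (∃ x ∈ l, q x) →
    ∃ A x B, l = A ++ x :: B ∧ q x ∧ ∀ y ∈ A, ¬ q y
  | [], h => by simp at h
  | a :: l, h => by
    by_cases ha : q a
    · exact ⟨[], a, l, rfl, ha, by simp⟩
    · obtain ⟨A, x, B, e, hx, hA⟩ := exists_first (q := q) (l := l) (by simpa [ha] using h)
      refine ⟨a :: A, x, B, by rw [e]; rfl, hx, ?_⟩
      simpa [ha] using hA

lemma mem_records_append {x : Entry} {B : List Entry} : ∀ {A : List Entry},
    x ∈ records (A ++ B) → x ∈ A ∨ x ∈ records B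
  | [], h => .inr h
  | a :: A, h => by
    rw [List.cons_append, records_cons, List.mem_cons, List.mem_filter] at h
    rcases h with rfl | h
    · exact .inl List.mem_cons_self
    · exact (mem_records_append h.1).imp_left (List.mem_cons_of_mem _)

/-- A permanent entry whose stack below it has committing records contradicts permanence. -/
lemma not_all_commits {s : ℕ} {P B : List Entry} {c : Entry} (h : stack R s = P ++ c :: B)
    (hperm : P ++ [c] <+: stack R (s + 1)) :
    ¬ ∀ E ∈ records (c :: B), Commits R (stage R s).1 E := by
  intro hall
  have hlen := cut_length_le (commits R (stage R s).1) P (c :: B) (by simp)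
    fun E hE => by simpa [commits] using hall E hE
  rw [← h] at hlen
  have h0 : P ++ [c] <+: stack R s := by rw [h]; exact ⟨B, by simp⟩
  rcases cut_spec (commits R (stage R s).1) (stack R s) with h' | ⟨d, t, h1, h2, h3⟩
  · rw [h', h] at hlen
    simp at hlen
  · have hcut : IsCut R s (cut (commits R (stage R s).1) (stack R s)).1 d t := by
      refine ⟨h1, fun E hE => by simpa [commits] using h3 E hE, ?_⟩
      rw [stage, step, rebuild, h2, head?_records]
      rfl
    have := (hcut.prefix_of_prefix h0 hperm).length_le
    rw [List.length_append, List.length_singleton] at this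
    omega

/-- Below a permanent entry which commits there is a permanent entry with a smaller requirement. -/
lemma IsPermanent.extend {s : ℕ} {P : List Entry} {c : Entry} (h : IsPermanent R s (P ++ [c]))
    (hc : ∀ t, s ≤ t → Commits R (stage R t).1 c) :
    ∃ A d, d.1 < c.1 ∧ IsPermanent R s (P ++ c :: A ++ [d]) := by
  obtain ⟨B, hB⟩ := h s (Nat.le_refl s)
  have hB' : stack R s = P ++ c :: B := by rw [← hB]; simp
  -- Otherwise c is the only record of the suffix it starts, and this suffix would be cut off.
  have hex : ∃ x ∈ B, x.1 < c.1 := by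
    by_contra hno
    push Not at hno
    refine not_all_commits hB' (h (s + 1) (by omega)) fun E hE => ?_
    have hEc : E = c := by
      rw [records_cons, List.mem_cons, List.mem_filter, decide_eq_true_eq] at hE
      rcases hE with hE | hE
      · exact hE
      · exact absurd hE.2 (Nat.not_lt.2 (hno E ((records_sublist B).subset hE.1)))
    rw [hEc]
    exact hc s (Nat.le_refl s)
  obtain ⟨A, d, D, rfl, hd, hA⟩ := exists_first hex
  refine ⟨A, d, hd, fun t ht => ?_⟩
  induction t, ht using Nat.le_induction with
  | base => rw [hB']; exact ⟨D, by simp⟩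
  | succ t ht ih =>
    obtain ⟨σ, K, hσ, hK, -, hor⟩ := exists_stack_succ R t
    rw [hK]
    rcases hor with rfl | ⟨c', t', hcut⟩
    · exact ih.trans (List.prefix_append _ _)
    rcases Nat.lt_or_ge σ.length (P ++ c :: A ++ [d]).length with h4 | h4
    swap
    · exact (List.prefix_of_prefix_length_le ih hσ h4).trans (List.prefix_append _ _)
    -- The cut falls after c but not after d. The requirements in A are no smaller than that of c,
    -- so the records of the suffix from c are c and records of the removed part. All of them
    -- commit, so the cut should have reached c.
    exfalso
    have h5 : P ++ [c] <+: σ := hcut.prefix_of_prefix (h t ht) (h (t + 1) (by omega))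
    obtain ⟨σ', rfl⟩ := h5
    obtain ⟨U, hU⟩ := List.prefix_of_prefix_length_le hσ ih h4.le
    obtain ⟨D', hD'⟩ := ih
    have heq := hcut.eq
    rw [← hD', ← hU, List.append_assoc] at heq
    have h6 := List.append_cancel_left heq
    have hU' : σ' ++ U = A ++ [d] := by
      have : (P ++ [c]) ++ (σ' ++ U) = (P ++ [c]) ++ (A ++ [d]) := by
        rw [← List.append_assoc, hU]; simp
      exact List.append_cancel_left this
    have hst : stack R t = P ++ c :: (σ' ++ (c' :: t')) := by rw [hcut.eq]; simp
    refine not_all_commits hst (h (t + 1) (by omega)) fun E hE => ?_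
    rw [records_cons, List.mem_cons, List.mem_filter, decide_eq_true_eq] at hE
    rcases hE with rfl | ⟨hE, hEc⟩
    · exact hc t ht
    · rcases mem_records_append hE with hE | hE
      · exfalso
        rcases List.eq_nil_or_concat U with rfl | ⟨U', u, rfl⟩
        · rw [← hU, List.append_nil] at h4
          omega
        · rw [List.concat_eq_append, ← List.append_assoc] at hU'
          obtain ⟨h8, -⟩ := List.append_inj' hU' rfl
          exact hA E (h8 ▸ List.mem_append_left _ hE) hEc
      · exact hcut.commits E hE

/-- A permanent list which is empty or ends with a requirement smaller than `b`. -/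
def IsSettled (R : ℕ → Bool) (b s : ℕ) (P : List Entry) : Prop :=
  IsPermanent R s P ∧ P.getLast?.elim 0 (fun c => c.1 + 1) ≤ b

/-- There is a maximal settled list. -/
lemma exists_settled (R : ℕ → Bool) (b : ℕ) : ∃ s P, IsSettled R b s P ∧
    ∀ s' A d, d.1 < b → ¬ IsPermanent R s' (P ++ A ++ [d]) := by
  set N : Set ℕ := {k | ∃ s P, IsSettled R b s P ∧ P.countP (fun x => x.1 < b) = k} with hN
  have hne : N.Nonempty := ⟨0, 0, [], ⟨fun t _ => List.nil_prefix, by simp⟩, rfl⟩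
  have hbdd : BddAbove N := by
    refine ⟨2 ^ b, ?_⟩
    rintro k ⟨s, P, ⟨hP, -⟩, rfl⟩
    have := count_lt_le (fun C x hC => (tidy_stage R s).free C x (hC.trans (hP s (Nat.le_refl s)))) b
    omega
  obtain ⟨s, P, hP, hk⟩ := Nat.sSup_mem hne hbdd
  refine ⟨s, P, hP, fun s' A d hd hperm => ?_⟩
  have hmem : (P ++ A ++ [d]).countP (fun x => x.1 < b) ∈ N :=
    ⟨s', _, ⟨hperm, by simpa [List.getLast?_append] using hd⟩, rfl⟩
  have hle := le_csSup hbdd hmem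
  rw [← hk, List.countP_append, List.countP_append, List.countP_singleton, if_pos (by simpa using hd)]
    at hle
  omega

/-- A list which is not permanent is cut at some stage. -/
lemma exists_cut {t : ℕ} {Q : List Entry} (h : Q <+: stack R t) (hn : ¬ IsPermanent R t Q) :
    ∃ u, t ≤ u ∧ Q <+: stack R u ∧ ¬ Q <+: stack R (u + 1) := by
  by_contra hno
  push Not at hno
  refine hn fun u hu => ?_
  induction u, hu using Nat.le_induction with
  | base => exact h
  | succ u hu ih => exact hno u hu ih

/-- If the part `A ++ w :: B` of the stack below a permanent part `P` is cut at or above `w`. -/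
lemma exists_isCut {u : ℕ} {P A : List Entry} {w : Entry}
    (hP : P <+: stack R u) (hP' : P <+: stack R (u + 1)) (h : P ++ A ++ [w] <+: stack R u)
    (hn : ¬ P ++ A ++ [w] <+: stack R (u + 1)) :
    ∃ A₁ A₂ B c t, A = A₁ ++ A₂ ∧ c :: t = A₂ ++ w :: B ∧ IsCut R u (P ++ A₁) c t := by
  obtain ⟨σ, K, hσ, hK, -, hor⟩ := exists_stack_succ R u
  rw [hK] at hn
  rcases hor with rfl | ⟨c, t, hcut⟩
  · exact absurd (h.trans (List.prefix_append _ _)) hn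
  obtain ⟨A₁, rfl⟩ := hcut.prefix_of_prefix hP hP'
  have hlt : (P ++ A₁).length < (P ++ A ++ [w]).length := by
    by_contra hge
    exact hn ((List.prefix_of_prefix_length_le h hσ (by omega)).trans (List.prefix_append _ _))
  obtain ⟨U, hU⟩ := List.prefix_of_prefix_length_le hσ h hlt.le
  rcases List.eq_nil_or_concat U with rfl | ⟨A₂, v, rfl⟩
  · rw [← hU, List.append_nil] at hlt
    omega
  rw [List.concat_eq_append, ← List.append_assoc] at hU
  obtain ⟨h1, h2⟩ := List.append_inj' hU rfl
  obtain ⟨rfl⟩ : v = w := by simpa using h2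
  rw [List.append_assoc] at h1
  obtain ⟨B, hB⟩ := h
  have heq := hcut.eq
  rw [← hB] at heq
  refine ⟨A₁, A₂, B, c, t, (List.append_cancel_left h1).symm, ?_, hcut⟩
  rw [← h1] at heq
  simp only [List.append_assoc] at heq
  simpa using (List.append_cancel_left (List.append_cancel_left heq)).symm

lemma todo_head {n : ℕ} {σ t : List Entry} {c : Entry} (h : Tidy n (σ ++ c :: t)) : ∃ N L,
    todo n σ (records (c :: t)) = (if newReq σ (records (c :: t)) + 2 ≤ c.2.1 then
      [(newReq σ (records (c :: t)), c.2.1)] else []) ++ (c.1, N) :: L ∧ c.2.1 < N := by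
  obtain ⟨h1, h2⟩ := h.records
  have hc := h2 c (by simp)
  have key : ∃ N L, reassign (n + 2) c.1 ((records t).filter fun x => x.1 < c.1) = (c.1, N) :: L ∧
      c.2.1 < N := by
    rw [records_cons] at h1 h2
    cases hrec : (records t).filter fun x => x.1 < c.1 with
    | nil => exact ⟨_, _, rfl, by omega⟩
    | cons b B =>
      rw [hrec] at h1
      exact ⟨_, _, rfl, ((List.pairwise_cons.1 h1).1 b List.mem_cons_self).2⟩
  obtain ⟨N, L, e, hN⟩ := key
  refine ⟨N, L.filter fun r => r.1 + 2 ≤ r.2, ?_, hN⟩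
  have hr : reassign (n + 2) (newReq σ (records (c :: t))) (records (c :: t)) =
      (newReq σ (records (c :: t)), c.2.1) :: (c.1, N) :: L := by
    rw [← e, records_cons, reassign]
  rw [todo, hr]
  have h3 : c.1 + 2 ≤ N := by omega
  simp only [List.filter_cons, h3, decide_true, if_true, decide_eq_true_eq]
  split_ifs <;> rfl

/-- The first requirement below a settled list becomes small. -/
lemma IsSettled.exists_le {b s : ℕ} {P : List Entry} (h : IsSettled R b s P) :
    ∃ t w B, IsPermanent R t P ∧ stack R t = P ++ w :: B ∧ w.1 ≤ b := by
  classical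
  have hex : ∃ s, IsPermanent R s P := ⟨s, h.1⟩
  -- At the first stage from which P is permanent, either P is the whole stack and the next
  -- requirement is one more than its last (or 0), or the last entry of P was just built and smaller
  -- requirements follow it.
  obtain ⟨s₀, hs₀, hmin⟩ : ∃ s₀, IsPermanent R s₀ P ∧ ∀ s < s₀, ¬ IsPermanent R s P :=
    ⟨Nat.find hex, Nat.find_spec hex, fun s hs => Nat.find_min hex hs⟩
  obtain ⟨B, hB⟩ := hs₀ s₀ (Nat.le_refl s₀)
  cases B with
  | nil =>
    rw [List.append_nil] at hB
    rcases isCut_or R s₀ with h' | ⟨σ, c, t, hcut⟩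
    · refine ⟨s₀ + 1, (P.getLast?.elim 0 (fun c => c.1 + 1), size R s₀ + 2, size R s₀), [],
        fun t ht => hs₀ t (by omega), ?_, h.2⟩
      rw [todo_nil (tidy_stage R s₀), List.foldl_cons, List.foldl_nil] at h'
      simp only [stack] at hB ⊢
      rw [h', push, ← hB]
    · exfalso
      have h1 := (hcut.prefix_of_prefix (hs₀ s₀ (Nat.le_refl s₀)) (hs₀ _ (by omega))).length_le
      rw [hB, hcut.eq] at h1
      simp at h1
  | cons w B =>
    refine ⟨s₀, w, B, hs₀, hB.symm, ?_⟩
    cases s₀ with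
    | zero => simp [stack, stage] at hB
    | succ s₁ =>
      have hnp : ¬ P <+: stack R s₁ := fun hp => hmin s₁ (by omega) fun t ht => by
        rcases eq_or_lt_of_le ht with rfl | ht
        · exact hp
        · exact hs₀ t ht
      obtain ⟨σ, K, hσ, hK, hdec, -⟩ := exists_stack_succ R s₁
      rw [hK] at hB
      have hlt : σ.length < P.length := by
        by_contra hge
        exact hnp ((List.prefix_of_prefix_length_le ⟨_, hB⟩ (List.prefix_append σ K)
          (by omega)).trans hσ)
      obtain ⟨K₁, rfl⟩ := List.prefix_of_prefix_length_le (List.prefix_append σ K) ⟨_, hB⟩ hlt.le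
      rcases List.eq_nil_or_concat K₁ with rfl | ⟨K₂, x, rfl⟩
      · simp at hlt
      rw [List.concat_eq_append] at hB hlt
      have h2 := h.2
      rw [List.concat_eq_append, ← List.append_assoc, List.getLast?_append] at h2
      rw [List.append_assoc] at hB
      have h3 := List.append_cancel_left hB
      rw [← h3, List.append_assoc] at hdec
      have h4 := (List.pairwise_cons.1 (List.pairwise_append.1 hdec).2.1).1 w (by simp)
      simp at h2
      omega

/-- The first requirement below a maximal settled list becomes the next one. -/
lemma IsSettled.exists_eq {b s : ℕ} {P : List Entry} (h : IsSettled R b s P)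
    (hmax : ∀ s' A d, d.1 < b → ¬ IsPermanent R s' (P ++ A ++ [d])) :
    ∃ t w B, IsPermanent R t P ∧ stack R t = P ++ w :: B ∧ w.1 = b := by
  -- A first requirement below b is cut off by maximality. Then a larger one, still at most b, takes
  -- its place, or it returns with a larger era. The latter needs an era below b + 2, whence the
  -- lexicographic induction.
  have key : ∀ k j t w B, b - w.1 ≤ k → b + 3 - w.2.1 ≤ j → IsPermanent R t P →
      stack R t = P ++ w :: B → w.1 ≤ b →
      ∃ t w B, IsPermanent R t P ∧ stack R t = P ++ w :: B ∧ w.1 = b := by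
    intro k
    induction k with
    | zero => exact fun j t w B hk _ hP hst hw => ⟨t, w, B, hP, hst, by omega⟩
    | succ k ihk =>
      intro j
      induction j using Nat.strong_induction_on with
      | _ j ihj =>
      intro t w B hk hj hP hst hw
      rcases eq_or_lt_of_le hw with hw' | hw'
      · exact ⟨t, w, B, hP, hst, hw'⟩
      have hpre : P ++ [] ++ [w] <+: stack R t := by rw [hst]; exact ⟨B, by simp⟩
      obtain ⟨u, htu, hu, hu'⟩ := exists_cut hpre (hmax t [] w hw')
      obtain ⟨A₁, A₂, D, c, r, hA, hcr, hcut⟩ := exists_isCut (hP u htu) (hP (u + 1) (by omega)) hu hu'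
      obtain ⟨rfl, rfl⟩ := List.append_eq_nil_iff.1 hA.symm
      simp only [List.nil_append, List.cons.injEq, List.append_nil] at hcr hcut
      obtain ⟨rfl, rfl⟩ := hcr
      have hP' : IsPermanent R (u + 1) P := fun t' ht' => hP t' (by omega)
      obtain ⟨N, L, htodo, hN⟩ := todo_head hcut.tidy
      obtain ⟨K, hK, hKm⟩ := foldl_push_stack (todo (size R u) P (records (c :: r)))
        ((stage R u).1, 2 * c.2.2, P)
      rw [← hcut.next] at hK
      have hv : newReq P (records (c :: r)) = max (P.getLast?.elim 0 fun c => c.1 + 1) (c.1 + 1) := by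
        rw [newReq, head?_records]
        rfl
      have h2 := h.2
      rw [htodo] at hKm
      split_ifs at hKm with hif
      · cases K with
        | nil => simp at hKm
        | cons x K =>
          simp only [List.map_cons, List.cons_append, List.cons.injEq, Prod.mk.injEq] at hKm
          refine ihk (b + 3 - x.2.1) (u + 1) x K ?_ (Nat.le_refl _) hP' hK ?_ <;> omega
      · cases K with
        | nil => simp at hKm
        | cons x K =>
          simp only [List.map_cons, List.nil_append, List.cons.injEq, Prod.mk.injEq] at hKm
          refine ihj (b + 3 - x.2.1) ?_ (u + 1) x K ?_ (Nat.le_refl _) hP' hK ?_ <;> omega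
  obtain ⟨t, w, B, h1, h2, h3⟩ := h.exists_le
  exact key _ _ t w B (Nat.le_refl _) (Nat.le_refl _) h1 h2 h3

/-! ### The tree differs from the listed relations -/

/-- Permanent modules commit to a relation which is isomorphic to the tree. -/
lemma IsPermanent.eventually_commits {s : ℕ} {P : List Entry} {c : Entry}
    (h : IsPermanent R s (P ++ [c])) (f : le (parent R) ≃r Rel R c.1) :
    ∃ u, s ≤ u ∧ ∀ t, u ≤ t → Commits R (stage R t).1 c := by
  have hp := isParent_parent R
  set l : List ℕ := (List.range (side c + 1)).map f with hl
  have hl' : ∀ i < side c + 1, decodeMap (Encodable.encode l) i = f i := by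
    intro i hi
    rw [decodeMap, Denumerable.ofNat_encode, List.getD_eq_getElem _ _ (by simpa [hl] using hi)]
    simp [hl]
  obtain ⟨M, hM⟩ : ∃ M, ∀ i < side c + 1, f i ≤ M := by
    refine ⟨(Finset.range (side c + 1)).sup f, fun i hi => ?_⟩
    exact Finset.le_sup (f := f) (Finset.mem_range.2 hi)
  -- The size at stage t exceeds t, hence all the bounds in `Commits`.
  refine ⟨s + M + Encodable.encode l + c.1, by omega, fun t ht => ?_⟩
  have hsize := lt_length_stage R t
  have hcomm : ∀ {i j}, le (parent R) i j ↔ Rel R c.1 (f i) (f j) := f.map_rel_iff.symm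
  have hst : ∀ t, s ≤ t → c ∈ stack R t := fun t ht => (h t ht).subset (by simp)
  have hside : side c < (stage R t).1.length := side_lt_size (hst t (by omega))
  refine ⟨by omega, Encodable.encode l, by omega, fun i hi => ?_, fun i hi j hj => ?_,
    fun y hy => ?_⟩
  · rw [hl' i hi]
    have := hM i hi
    omega
  · rw [hl' i hi, hl' j hj, hp.reaches_iff (agrees_stage R t) (by omega)]
    exact hcomm
  · by_cases hi : f.symm y < side c + 1
    · exact .inl ⟨f.symm y, hi, by rw [hl' _ hi, f.apply_symm_apply]⟩
    · right
      rw [hl' _ (by omega)]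
      -- The preimage of y may be built much later. Since c is permanent, whatever is built then
      -- still goes below its longer branch.
      have h1 : le (parent R) (f.symm y) (side c) := by
        have hv := valid_stage R (max s (f.symm y))
        have hc := hst (max s (f.symm y)) (le_max_left _ _)
        have hlt := lt_length_stage R (max s (f.symm y))
        have hle := le_max_right s (f.symm y)
        have b := hv.block c hc
        have hbot := hv.bottom_lt hc
        have hb := hv.le_bottom c hc (f.symm y)
        simp only [bottom, side] at *
        rcases Nat.lt_or_ge (f.symm y) (4 * c.2.2 + 6 + 2 * width c) with h2 | h2
        · exact b.le_side (by omega) h2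
        · exact le_trans (hb (by omega) (by omega)) (b.le_side (by omega) (by omega))
      have := hcomm.1 h1
      rwa [f.apply_symm_apply] at this

/-- The images of the ends of successive modules for b form an ascending chain in S, and the stems
above these ends become arbitrarily long. -/
theorem not_iso {b : ℕ} (hS : IsPosetTree (Rel R b)) (f : le (parent R) ≃r Rel R b) : False := by
  have hp := isParent_parent R
  obtain ⟨s, P, hP, hmax⟩ := exists_settled R b
  -- Only larger requirements stand between P and a leader, so it is a record of any suffix that
  -- starts after P and contains it.
  let IsLeader : ℕ → Entry → Prop := fun t w => IsPermanent R t P ∧ w.1 = b ∧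
    ∃ A B, stack R t = P ++ A ++ w :: B ∧ ∀ E ∈ A, b < E.1
  let IsGood : ℕ → Entry → (ℕ → ℕ) → Prop := fun u w g => w ∈ stack R u ∧
    IsCommitment (parent R) (Rel R b) (size R u) (side w) g
  let End : Entry → ℕ → Prop := fun w i => i = 2 * w.2.2 + 2 ∨ i = side w
  have hact : ∀ t w, IsLeader t w → ∃ u g w', t ≤ u ∧ IsGood u w g ∧ IsLeader (u + 1) w' ∧
      u < w'.2.2 ∧ ∀ u' g', u + 1 ≤ u' → IsGood u' w' g' → ∀ i, End w i →
        ∃ i', End w' i' ∧ Rel R b (g i) (g' i') := by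
    rintro t w ⟨hPt, hwb, A, B, hst, hA⟩
    have hpre : P ++ A ++ [w] <+: stack R t := by rw [hst]; exact ⟨B, by simp⟩
    -- A permanent leader would commit from some stage on and be followed by a permanent smaller
    -- requirement, against `hmax`.
    have hnp : ¬ IsPermanent R t (P ++ A ++ [w]) := by
      intro hperm
      subst hwb
      obtain ⟨u, htu, hu⟩ := hperm.eventually_commits f
      obtain ⟨A', d, hd, hd'⟩ := IsPermanent.extend (s := u) (fun t' ht' => hperm t' (by omega)) hu
      exact hmax u (A ++ w :: A') d hd (by simpa using hd')
    obtain ⟨u, htu, hu, hu'⟩ := exists_cut hpre hnp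
    obtain ⟨A₁, A₂, D, c, r, rfl, hcr, hcut⟩ :=
      exists_isCut (hPt u htu) (hPt (u + 1) (by omega)) hu hu'
    have hw : w ∈ records (c :: r) := by
      rw [hcr]
      exact mem_records.2 ⟨A₂, D, rfl, fun y hy => by
        rw [hwb]; exact hA y (List.mem_append_right _ hy)⟩
    obtain ⟨C₁, C₂, hC⟩ := List.append_of_mem hw
    obtain ⟨w', K, K', hw'1, hw'2, hst', hK, hdesc⟩ := hcut.exists_next hC
    have hwu : w ∈ stack R u := hu.subset (by simp)
    obtain ⟨g, hg⟩ := (hcut.commits w hw).isCommitment hp (agrees_stage R u) (side_lt_size hwu)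
    rw [hwb] at hg
    refine ⟨u, g, w', htu, ⟨hwu, hg⟩, ⟨fun t' ht' => hPt t' (by omega), hw'1.trans hwb, A₁ ++ K, K',
      by rw [hst']; simp, fun E hE => ?_⟩, ?_, fun u' g' hu'' hg' i hi => ?_⟩
    · rcases List.mem_append.1 hE with hE | hE
      · exact hA E (List.mem_append_left _ hE)
      · rw [← hwb]
        exact hK E hE
    · exact (lt_length_stage R u).trans_le hw'2
    · rcases hdesc u' _ g g' hu'' hg'.1 hS hg hg'.2 i hi with h | h
      · exact ⟨_, .inl rfl, h⟩
      · exact ⟨_, .inr rfl, h⟩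
  obtain ⟨t₀, w₀, B, h1, h2, h3⟩ := hP.exists_eq hmax
  have hlead₀ : IsLeader t₀ w₀ := ⟨h1, h3, [], B, by simpa using h2, by simp⟩
  let IsAct : ℕ → Entry → (ℕ → ℕ) → Entry → Prop := fun u w g w' => IsGood u w g ∧
    IsLeader (u + 1) w' ∧ u < w'.2.2 ∧ ∀ u' g', u + 1 ≤ u' → IsGood u' w' g' → ∀ i, End w i →
      ∃ i', End w' i' ∧ Rel R b (g i) (g' i')
  have hchain : ∀ k u w g w', IsAct u w g w' → ∀ i, End w i → ∃ u' v g' i', IsGood u' v g' ∧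
      End v i' ∧ u + k ≤ v.2.2 ∧ Rel R b (g i) (g' i') := by
    intro k
    induction k with
    | zero =>
      rintro u w g w' ⟨-, hl, hlt, hd⟩ i hi
      obtain ⟨u', g', -, hu', hg', -⟩ := hact _ w' hl
      obtain ⟨i', hi', hS'⟩ := hd u' g' hu' hg' i hi
      exact ⟨u', w', g', i', hg', hi', hlt.le, hS'⟩
    | succ k ih =>
      rintro u w g w' ⟨-, hl, hlt, hd⟩ i hi
      obtain ⟨u', g', w'', hu', hg', hact'⟩ := hact _ w' hl
      obtain ⟨i', hi', hS'⟩ := hd u' g' hu' hg' i hi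
      obtain ⟨u'', v, g'', j, h1, h2, h3, h4⟩ := ih u' w' g' w'' ⟨hg', hact'⟩ i' hi'
      exact ⟨u'', v, g'', j, h1, h2, by omega, hS.2.2.1 _ _ _ hS' h4⟩
  obtain ⟨u, g, w', -, hgood, hact'⟩ := hact _ _ hlead₀
  have hfin := (hS.2.2.2.2 (g (side w₀))).1
  -- The stem of v has `v.2.2` elements, which this length of the chain makes more than S has above
  -- the first image.
  obtain ⟨u', v, g', i, ⟨hv, hg'⟩, hi, hk, hle⟩ :=
    hchain (hfin.toFinset.card + 1) u w₀ g w' ⟨hgood, hact'⟩ (side w₀) (.inr rfl)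
  have bv := (valid_stage R u').block v hv
  have hside : side v = 2 * v.2.2 + 2 + width v := rfl
  change i = 2 * v.2.2 + 2 ∨ i = side v at hi
  rw [hside] at hi hg'
  have hsub : (Finset.Ico v.2.2 (2 * v.2.2)).image g' ⊆ hfin.toFinset := by
    intro y hy
    obtain ⟨x, hx, rfl⟩ := Finset.mem_image.1 hy
    rw [Finset.mem_Ico] at hx
    rw [Set.Finite.mem_toFinset]
    refine hS.2.2.1 _ _ _ hle ((hg'.iff i (by omega) x (by omega)).1 ?_)
    exact le_trans (bv.le_root (by omega) (by omega)) (bv.le_stem hx.1 hx.2)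
  have := Finset.card_le_card hsub
  rw [Finset.card_image_of_injOn ((hg'.injOn hp hS).mono fun x hx => by
    rw [Finset.mem_coe, Finset.mem_Ico] at hx
    exact show x < _ by omega), Nat.card_Ico] at this
  omega

/-! ### A universal sequence of relations -/

open Nat.Partrec (Code)

/-- Replace the minimizations in a code by the code of a constant function. -/
def dropMin (c : Code) : Code :=
  Code.recOn (motive := fun _ => Code) c .zero .succ .left .right (fun _ _ a b => .pair a b)
    (fun _ _ a b => .comp a b) (fun _ _ a b => .prec a b) (fun _ _ => .zero)

lemma primrec_dropMin : Primrec dropMin := by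
  refine Code.primrec_recOn (α := Code) (σ := Code) (c := id) Primrec.id
    (Primrec.const Code.zero) (Primrec.const Code.succ) (Primrec.const Code.left)
    (Primrec.const Code.right) (pr := fun _ _ _ a b => .pair a b) ?_
    (co := fun _ _ _ a b => .comp a b) ?_ (pc := fun _ _ _ a b => .prec a b) ?_
    (rf := fun _ _ _ => .zero) (Primrec.const Code.zero)
  · exact Code.primrec₂_pair.comp (Primrec.fst.comp (Primrec.snd.comp (Primrec.snd.comp Primrec.snd)))
      (Primrec.snd.comp (Primrec.snd.comp (Primrec.snd.comp Primrec.snd)))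
  · exact Code.primrec₂_comp.comp (Primrec.fst.comp (Primrec.snd.comp (Primrec.snd.comp Primrec.snd)))
      (Primrec.snd.comp (Primrec.snd.comp (Primrec.snd.comp Primrec.snd)))
  · exact Code.primrec₂_prec.comp (Primrec.fst.comp (Primrec.snd.comp (Primrec.snd.comp Primrec.snd)))
      (Primrec.snd.comp (Primrec.snd.comp (Primrec.snd.comp Primrec.snd)))

/-- Only minimization can diverge, so evaluating all these codes gives a total computable
enumeration. -/
lemma dom_eval_dropMin (c : Code) : ∀ n, (Code.eval (dropMin c) n).Dom := by
  induction c with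
  | zero => exact fun _ => trivial
  | succ => exact fun _ => trivial
  | left => exact fun _ => trivial
  | right => exact fun _ => trivial
  | pair a b iha ihb =>
    intro n
    change (Nat.pair <$> Code.eval (dropMin a) n <*> Code.eval (dropMin b) n).Dom
    simp [Seq.seq, iha n, ihb n]
  | comp a b iha ihb =>
    intro n
    change (Code.eval (dropMin b) n >>= Code.eval (dropMin a)).Dom
    exact ⟨ihb n, iha _⟩
  | prec a b iha ihb =>
    intro n
    obtain ⟨x, k, rfl⟩ : ∃ x k, n = Nat.pair x k := ⟨_, _, (Nat.pair_unpair n).symm⟩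
    change (Code.eval (.prec (dropMin a) (dropMin b)) (Nat.pair x k)).Dom
    induction k with
    | zero => rw [Code.eval_prec_zero]; exact iha x
    | succ k ih => rw [Code.eval_prec_succ]; exact ⟨ih, ihb _⟩
  | rfind' a _ => exact fun _ => trivial

lemma exists_dropMin_eval {f : ℕ → ℕ} (hf : Nat.Primrec f) :
    ∃ c, ∀ n, f n ∈ Code.eval (dropMin c) n := by
  induction hf with
  | zero => exact ⟨.zero, fun n => Part.mem_some _⟩
  | succ => exact ⟨.succ, fun n => Part.mem_some _⟩
  | left => exact ⟨.left, fun n => Part.mem_some _⟩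
  | right => exact ⟨.right, fun n => Part.mem_some _⟩
  | @pair f g _ _ ihf ihg =>
    obtain ⟨a, ha⟩ := ihf
    obtain ⟨b, hb⟩ := ihg
    refine ⟨.pair a b, fun n => ?_⟩
    change Nat.pair (f n) (g n) ∈
      Nat.pair <$> Code.eval (dropMin a) n <*> Code.eval (dropMin b) n
    rw [Part.eq_some_iff.2 (ha n), Part.eq_some_iff.2 (hb n)]
    simp [Seq.seq]
  | @comp f g _ _ ihf ihg =>
    obtain ⟨a, ha⟩ := ihf
    obtain ⟨b, hb⟩ := ihg
    exact ⟨.comp a b, fun n => Part.mem_bind (hb n) (ha _)⟩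
  | @prec f g _ _ ihf ihg =>
    obtain ⟨a, ha⟩ := ihf
    obtain ⟨b, hb⟩ := ihg
    refine ⟨.prec a b, fun n => ?_⟩
    change _ ∈ Code.eval (.prec (dropMin a) (dropMin b)) n
    obtain ⟨x, k, rfl⟩ : ∃ x k, n = Nat.pair x k := ⟨_, _, (Nat.pair_unpair n).symm⟩
    simp only [Nat.unpaired, Nat.unpair_pair]
    induction k with
    | zero => rw [Code.eval_prec_zero]; exact ha x
    | succ k ih => rw [Code.eval_prec_succ]; exact Part.mem_bind ih (hb _)

/-- There is a computable sequence of relations which contains all primitive recursive ones. -/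
theorem exists_universal : ∃ R : ℕ → Bool, Computable R ∧
    ∀ s : ℕ → ℕ → Prop, PrimrecRel s → ∃ e, ∀ x y, Rel R e x y ↔ s x y := by
  let U : ℕ → ℕ := fun k => (Code.eval (dropMin (Denumerable.ofNat Code k.unpair.1)) k.unpair.2).get
    (dom_eval_dropMin _ _)
  have hU : Computable U := by
    refine Partrec.of_eq_tot (f := fun k : ℕ =>
      Code.eval (dropMin (Denumerable.ofNat Code k.unpair.1)) k.unpair.2) ?_ fun k => Part.get_mem _
    exact Code.eval_part.comp (primrec_dropMin.to_comp.comp ((Computable.ofNat Code).comp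
      (Computable.fst.comp Computable.unpair))) (Computable.snd.comp Computable.unpair)
  refine ⟨fun k => decide (U k = 1),
    (Primrec.eq.comp Primrec.id (Primrec.const 1)).decide.to_comp.comp hU, fun s hs => ?_⟩
  classical
  have hf : Nat.Primrec fun n : ℕ => if s n.unpair.1 n.unpair.2 then 1 else 0 :=
    Primrec.nat_iff.1 (Primrec.ite (hs.comp (Primrec.fst.comp Primrec.unpair)
      (Primrec.snd.comp Primrec.unpair)) (Primrec.const 1) (Primrec.const 0))
  obtain ⟨c, hc⟩ := exists_dropMin_eval hf
  refine ⟨Encodable.encode c, fun x y => ?_⟩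
  have h1 : U (Nat.pair (Encodable.encode c) (Nat.pair x y)) = if s x y then 1 else 0 := by
    have h2 := hc (Nat.pair x y)
    simp only [Nat.unpair_pair] at h2
    refine Part.get_eq_of_mem ?_ _
    simpa using h2
  rw [Rel, h1]
  split_ifs with h <;> simp [h]

/-! ### Computability of the construction -/

section Primrec

variable {α β : Type} [Primcodable α] [Primcodable β]

lemma primrecPred_exists_lt {q : α → ℕ → Prop} {f : α → ℕ} (hf : Primrec f)
    (hq : PrimrecRel q) : PrimrecPred fun a => ∃ x < f a, q a x :=
  (PrimrecRel.comp (hq.swap.exists_mem_list) (Primrec.list_range.comp hf) Primrec.id).of_eq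
    fun a => by simp [Function.swap]

lemma primrecPred_forall_lt {q : α → ℕ → Prop} {f : α → ℕ} (hf : Primrec f)
    (hq : PrimrecRel q) : PrimrecPred fun a => ∀ x < f a, q a x :=
  (PrimrecRel.comp (hq.swap.forall_mem_list) (Primrec.list_range.comp hf) Primrec.id).of_eq
    fun a => by simp [Function.swap]

lemma primrec_width : Primrec width :=
  Primrec.nat_sub.comp (Primrec.fst.comp Primrec.snd) Primrec.fst

lemma primrec_side : Primrec side :=
  Primrec.nat_add.comp (Primrec.nat_add.comp (Primrec.nat_mul.comp (Primrec.const 2)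
    (Primrec.snd.comp Primrec.snd)) (Primrec.const 2)) primrec_width

lemma primrecPred_reaches {l : α → List ℕ} {f g : α → ℕ} (hl : Primrec l) (hf : Primrec f)
    (hg : Primrec g) : PrimrecPred fun a => Reaches (l a) (f a) (g a) := by
  refine primrecPred_exists_lt (Primrec.succ.comp hf) ?_
  refine Primrec.eq.comp (Primrec.nat_iterate Primrec.snd (hf.comp Primrec.fst) ?_)
    (hg.comp Primrec.fst)
  exact (Primrec.list_getD 0).comp (hl.comp (Primrec.fst.comp Primrec.fst)) Primrec.snd

lemma primrec₂_decodeMap : Primrec₂ decodeMap :=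
  (Primrec.list_getD 0).comp ((Primrec.ofNat (List ℕ)).comp Primrec.fst) Primrec.snd

/-- The sequence of relations coded by a finite table. -/
def tableFun (T : List Bool) (k : ℕ) : Bool := T.getD k false

lemma primrecPred_rel {T : α → List Bool} {e x y : α → ℕ} (hT : Primrec T) (he : Primrec e)
    (hx : Primrec x) (hy : Primrec y) :
    PrimrecPred fun a => Rel (tableFun (T a)) (e a) (x a) (y a) :=
  Primrec.eq.comp ((Primrec.list_getD false).comp hT
    (Primrec₂.natPair.comp he (Primrec₂.natPair.comp hx hy))) (Primrec.const true)

lemma _root_.PrimrecPred.iff {q r : α → Prop} (hq : PrimrecPred q) (hr : PrimrecPred r) :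
    PrimrecPred fun a => (q a ↔ r a) :=
  ((hq.and hr).or (hq.not.and hr.not)).of_eq fun a => by tauto

/-- All quantifiers in `Commits`, including the one over codes of g, are bounded. -/
lemma primrecPred_commits {T : α → List Bool} {l : α → List ℕ} {E : α → Entry} (hT : Primrec T)
    (hl : Primrec l) (hE : Primrec E) :
    PrimrecPred fun a => Commits (tableFun (T a)) (l a) (E a) := by
  have hn := Primrec.list_length.comp hl
  have hs := Primrec.succ.comp (primrec_side.comp hE)
  have he := Primrec.fst.comp hE
  refine (Primrec.nat_le.comp he hn).and (primrecPred_exists_lt hn ?_)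
  refine PrimrecPred.and ?_ (PrimrecPred.and ?_ ?_)
  · refine primrecPred_forall_lt (hs.comp Primrec.fst) (Primrec.nat_lt.comp ?_ ?_)
    · exact primrec₂_decodeMap.comp (Primrec.snd.comp Primrec.fst) Primrec.snd
    · exact Primrec.succ.comp (hn.comp (Primrec.fst.comp Primrec.fst))
  · refine primrecPred_forall_lt (hs.comp Primrec.fst) (primrecPred_forall_lt
      (hs.comp (Primrec.fst.comp Primrec.fst)) (PrimrecPred.iff ?_ ?_))
    · exact primrecPred_reaches (hl.comp (Primrec.fst.comp (Primrec.fst.comp Primrec.fst)))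
        (Primrec.snd.comp Primrec.fst) Primrec.snd
    · have h1 := (Primrec.fst (α := α) (β := ℕ)).comp
        ((Primrec.fst (α := α × ℕ) (β := ℕ)).comp (Primrec.fst (α := (α × ℕ) × ℕ) (β := ℕ)))
      have hc := (Primrec.snd (α := α) (β := ℕ)).comp
        ((Primrec.fst (α := α × ℕ) (β := ℕ)).comp (Primrec.fst (α := (α × ℕ) × ℕ) (β := ℕ)))
      exact primrecPred_rel (hT.comp h1) (he.comp h1)
        (primrec₂_decodeMap.comp hc (Primrec.snd.comp Primrec.fst))
        (primrec₂_decodeMap.comp hc Primrec.snd)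
  · refine primrecPred_forall_lt (Primrec.succ.comp (hn.comp Primrec.fst)) (PrimrecPred.or ?_ ?_)
    · refine primrecPred_exists_lt (hs.comp (Primrec.fst.comp Primrec.fst)) (Primrec.eq.comp ?_ ?_)
      · exact primrec₂_decodeMap.comp (Primrec.snd.comp (Primrec.fst.comp Primrec.fst)) Primrec.snd
      · exact Primrec.snd.comp Primrec.fst
    · have h1 := (Primrec.fst (α := α) (β := ℕ)).comp (Primrec.fst (α := α × ℕ) (β := ℕ))
      have hc := (Primrec.snd (α := α) (β := ℕ)).comp (Primrec.fst (α := α × ℕ) (β := ℕ))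
      exact primrecPred_rel (hT.comp h1) (he.comp h1) Primrec.snd
        (primrec₂_decodeMap.comp hc (primrec_side.comp (hE.comp h1)))

lemma primrec_records : Primrec records := by
  refine Primrec.list_foldr (h := fun (_ : List Entry) q => q.1 :: q.2.filter fun x => x.1 < q.1.1)
    Primrec.id (Primrec.const []) ?_
  refine Primrec.list_cons.comp (Primrec.fst.comp Primrec.snd) ?_
  have hr : PrimrecRel fun (x : Entry) (n : ℕ) => x.1 < n :=
    Primrec.nat_lt.comp (Primrec.fst.comp Primrec.fst) Primrec.snd
  exact hr.listFilter.comp (Primrec.snd.comp Primrec.snd)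
    (Primrec.fst.comp (Primrec.fst.comp Primrec.snd))

lemma primrec_cut {T : α → List Bool} {l : α → List ℕ} {st : α → List Entry} (hT : Primrec T)
    (hl : Primrec l) (hst : Primrec st) :
    Primrec fun a => cut (commits (tableFun (T a)) (l a)) (st a) := by
  classical
  have hall : PrimrecRel fun (a : α) (k : List Entry) =>
      ∀ E ∈ records k, Commits (tableFun (T a)) (l a) E := by
    have h1 : PrimrecRel fun (E : Entry) (a : α) => Commits (tableFun (T a)) (l a) E :=
      primrecPred_commits (hT.comp Primrec.snd) (hl.comp Primrec.snd) Primrec.fst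
    exact h1.forall_mem_list.comp (primrec_records.comp Primrec.snd) Primrec.fst
  have hmain : Primrec fun a => List.rec (motive := fun _ => List Entry × List Entry) ([], [])
      (fun c t ih => if ∀ E ∈ records (c :: t), Commits (tableFun (T a)) (l a) E then
        ([], records (c :: t)) else (c :: ih.1, ih.2)) (st a) := by
    refine Primrec.list_rec (h := fun a q => if ∀ E ∈ records (q.1 :: q.2.1),
      Commits (tableFun (T a)) (l a) E then (([] : List Entry), records (q.1 :: q.2.1))
        else (q.1 :: q.2.2.1, q.2.2.2)) hst (Primrec.const _) ?_
    have hcons : Primrec fun q : α × Entry × List Entry × List Entry × List Entry =>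
        q.2.1 :: q.2.2.1 :=
      Primrec.list_cons.comp (Primrec.fst.comp Primrec.snd)
        (Primrec.fst.comp (Primrec.snd.comp Primrec.snd))
    refine Primrec.ite (hall.comp Primrec.fst hcons)
      (Primrec.pair (Primrec.const _) (primrec_records.comp hcons)) (Primrec.pair ?_ ?_)
    · exact Primrec.list_cons.comp (Primrec.fst.comp Primrec.snd)
        (Primrec.fst.comp (Primrec.snd.comp (Primrec.snd.comp Primrec.snd)))
    · exact Primrec.snd.comp (Primrec.snd.comp (Primrec.snd.comp Primrec.snd))
  refine hmain.of_eq fun a => ?_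
  induction st a with
  | nil => rfl
  | cons c t ih =>
    simp only [cut, ← ih, List.all_eq_true, commits, decide_eq_true_eq]

lemma primrec_block : Primrec fun q : ℕ × ℕ × ℕ => block q.1 q.2.1 q.2.2 := by
  have hm : Primrec fun q : ℕ × ℕ × ℕ => q.2.1 := Primrec.fst.comp Primrec.snd
  have hQ : Primrec fun q : ℕ × ℕ × ℕ => q.2.2 := Primrec.snd.comp Primrec.snd
  refine Primrec.list_map (Primrec.list_range.comp (Primrec.nat_add.comp (Primrec.nat_add.comp
    (Primrec.nat_mul.comp (Primrec.const 3) hm) (Primrec.const 6))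
    (Primrec.nat_mul.comp (Primrec.const 2) hQ))) ?_
  have hm' := hm.comp (Primrec.fst (α := ℕ × ℕ × ℕ) (β := ℕ))
  have hQ' := hQ.comp (Primrec.fst (α := ℕ × ℕ × ℕ) (β := ℕ))
  have h2m := Primrec.nat_mul.comp (Primrec.const 2) hm'
  refine Primrec.ite (Primrec.eq.comp Primrec.snd (Primrec.const 0))
    (Primrec.fst.comp Primrec.fst) ?_
  refine Primrec.ite (Primrec.eq.comp Primrec.snd (Primrec.nat_add.comp hm' (Primrec.const 1)))
    (Primrec.nat_sub.comp h2m (Primrec.const 1)) ?_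
  refine Primrec.ite (Primrec.eq.comp Primrec.snd (Primrec.nat_add.comp (Primrec.nat_add.comp hm'
    (Primrec.const 2)) hQ')) (Primrec.nat_add.comp h2m (Primrec.const 1)) ?_
  exact Primrec.nat_sub.comp (Primrec.nat_add.comp hm' Primrec.snd) (Primrec.const 1)

lemma primrec₂_push : Primrec₂ push := by
  have hn : Primrec fun q : State × (ℕ × ℕ) => q.1.1.length :=
    Primrec.list_length.comp (Primrec.fst.comp Primrec.fst)
  have he : Primrec fun q : State × (ℕ × ℕ) => q.2.1 := Primrec.fst.comp Primrec.snd
  have hN : Primrec fun q : State × (ℕ × ℕ) => q.2.2 := Primrec.snd.comp Primrec.snd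
  have hQ := Primrec.nat_sub.comp hN he
  refine Primrec.pair ?_ (Primrec.pair ?_ ?_)
  · refine Primrec.list_append.comp (Primrec.fst.comp Primrec.fst) ?_
    exact primrec_block.comp (Primrec.pair (Primrec.fst.comp (Primrec.snd.comp Primrec.fst))
      (Primrec.pair hn hQ))
  · exact Primrec.nat_add.comp (Primrec.nat_add.comp (Primrec.nat_mul.comp (Primrec.const 4) hn)
      (Primrec.const 5)) (Primrec.nat_mul.comp (Primrec.const 2) hQ)
  · exact Primrec.list_append.comp (Primrec.snd.comp (Primrec.snd.comp Primrec.fst))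
      (Primrec.list_cons.comp (Primrec.pair he (Primrec.pair hN hn)) (Primrec.const []))

/-- The recursion changes the parameter v; a left fold carries it along in its accumulator. -/
lemma reassign_eq_foldl (n : ℕ) : ∀ (ρ : List Entry) (v : ℕ) (acc : List (ℕ × ℕ)),
    acc ++ reassign n v ρ =
      (fun q : List (ℕ × ℕ) × ℕ => q.1 ++ [(q.2, n)])
        (ρ.foldl (fun q c => (q.1 ++ [(q.2, c.2.1)], c.1)) (acc, v))
  | [], _, _ => rfl
  | c :: t, v, acc => by
    rw [reassign, List.foldl_cons, ← reassign_eq_foldl n t c.1]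
    simp

lemma primrec_reassign {n v : α → ℕ} {ρ : α → List Entry} (hn : Primrec n) (hv : Primrec v)
    (hρ : Primrec ρ) : Primrec fun a => reassign (n a) (v a) (ρ a) := by
  have hf : Primrec fun a => (ρ a).foldl (fun (q : List (ℕ × ℕ) × ℕ) c =>
      (q.1 ++ [(q.2, c.2.1)], c.1)) (([] : List (ℕ × ℕ)), v a) := by
    refine Primrec.list_foldl (h := fun (_ : α) (q : (List (ℕ × ℕ) × ℕ) × Entry) =>
      (q.1.1 ++ [(q.1.2, q.2.2.1)], q.2.1)) hρ (Primrec.pair (Primrec.const _) hv) ?_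
    refine Primrec.pair (Primrec.list_append.comp (Primrec.fst.comp (Primrec.fst.comp Primrec.snd))
      (Primrec.list_cons.comp (Primrec.pair (Primrec.snd.comp (Primrec.fst.comp Primrec.snd))
        (Primrec.fst.comp (Primrec.snd.comp (Primrec.snd.comp Primrec.snd)))) (Primrec.const [])))
      (Primrec.fst.comp (Primrec.snd.comp Primrec.snd))
  refine (Primrec.list_append.comp (Primrec.fst.comp hf) (Primrec.list_cons.comp
    (Primrec.pair (Primrec.snd.comp hf) hn) (Primrec.const []))).of_eq fun a => ?_
  exact (reassign_eq_foldl (n a) (ρ a) (v a) []).symm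

lemma primrec₂_newReq : Primrec₂ newReq := by
  have h : ∀ {o : List Entry × List Entry → Option Entry}, Primrec o →
      Primrec fun q => (o q).elim 0 fun c => c.1 + 1 := by
    intro o ho
    refine (Primrec.option_casesOn ho (Primrec.const 0) (g := fun _ (c : Entry) => c.1 + 1)
      (Primrec.succ.comp ((Primrec.fst (α := ℕ) (β := ℕ × ℕ)).comp Primrec.snd))).of_eq fun q => ?_
    cases o q <;> rfl
  refine Primrec.nat_max.comp (h ?_) (h (Primrec.list_head?.comp Primrec.snd))
  exact (Primrec.list_head?.comp (Primrec.list_reverse.comp Primrec.fst)).of_eq fun q => by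
    rw [List.head?_reverse]

lemma primrec_todo {n : α → ℕ} {σ ρ : α → List Entry} (hn : Primrec n) (hσ : Primrec σ)
    (hρ : Primrec ρ) : Primrec fun a => todo (n a) (σ a) (ρ a) := by
  have hp : PrimrecPred fun r : ℕ × ℕ => r.1 + 2 ≤ r.2 :=
    Primrec.nat_le.comp (Primrec.nat_add.comp Primrec.fst (Primrec.const 2)) Primrec.snd
  exact (Primrec.listFilter hp).comp (primrec_reassign (Primrec.nat_add.comp hn (Primrec.const 2))
    (primrec₂_newReq.comp hσ hρ) hρ)

lemma primrec_rebuild {X : α → State} {σ ρ : α → List Entry} (hX : Primrec X) (hσ : Primrec σ)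
    (hρ : Primrec ρ) : Primrec fun a => rebuild (X a) (σ a) (ρ a) := by
  refine Primrec.list_foldl (h := fun (_ : α) (q : State × (ℕ × ℕ)) => push q.1 q.2)
    (primrec_todo (Primrec.list_length.comp (Primrec.fst.comp hX)) hσ hρ)
    (Primrec.pair (Primrec.fst.comp hX) (Primrec.pair ?_ hσ))
    (primrec₂_push.comp (Primrec.fst.comp Primrec.snd) (Primrec.snd.comp Primrec.snd))
  refine (Primrec.option_casesOn (Primrec.list_head?.comp hρ) (Primrec.fst.comp (Primrec.snd.comp hX))
    (g := fun _ c => 2 * c.2.2) (Primrec.nat_mul.comp (Primrec.const 2)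
      (Primrec.snd.comp (Primrec.snd.comp Primrec.snd)))).of_eq fun a => ?_
  cases (ρ a).head? <;> rfl

lemma primrec₂_step : Primrec₂ fun (T : List Bool) (X : State) => step (tableFun T) X := by
  have hcut := primrec_cut (α := List Bool × State) Primrec.fst (Primrec.fst.comp Primrec.snd)
    (Primrec.snd.comp (Primrec.snd.comp Primrec.snd))
  exact primrec_rebuild Primrec.snd (Primrec.fst.comp hcut) (Primrec.snd.comp hcut)

end Primrec

/-! ### From finite tables to the computable tree -/

/-- The number of values of a sequence that matter in a step with a tree of size `n`. -/
def useBound (n : ℕ) : ℕ := Nat.pair n (Nat.pair n n) + 1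

/-- The index and both arguments of every queried value are at most the size of the tree, and
`Nat.pair` is monotone. -/
lemma commits_congr {R R' : ℕ → Bool} {ps : List ℕ} (h : ∀ k < useBound ps.length, R k = R' k)
    (E : Entry) : Commits R ps E ↔ Commits R' ps E := by
  have hrel : E.1 ≤ ps.length → ∀ x < ps.length + 1, ∀ y < ps.length + 1,
      (Rel R E.1 x y ↔ Rel R' E.1 x y) := by
    intro hE x hx y hy
    rw [Rel, Rel, h]
    have h1 : ∀ {a b c d : ℕ}, a ≤ c → b ≤ d → Nat.pair a b ≤ Nat.pair c d := by
      intro a b c d hac hbd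
      rcases eq_or_lt_of_le hac with rfl | hac
      · rcases eq_or_lt_of_le hbd with rfl | hbd
        · exact Nat.le_refl _
        · exact (Nat.pair_lt_pair_right _ hbd).le
      · rcases eq_or_lt_of_le hbd with rfl | hbd
        · exact (Nat.pair_lt_pair_left _ hac).le
        · exact ((Nat.pair_lt_pair_left _ hac).trans (Nat.pair_lt_pair_right _ hbd)).le
    exact Nat.lt_succ_of_le (h1 hE (h1 (by omega) (by omega)))
  refine and_congr_right fun hE => exists_congr fun c => and_congr_right fun _ =>
    and_congr_right fun hc => ?_
  refine and_congr ?_ ?_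
  · refine forall₂_congr fun i hi => forall₂_congr fun j hj => ?_
    rw [hrel hE _ (hc i hi) _ (hc j hj)]
  · refine forall₂_congr fun y hy => ?_
    rw [hrel hE y hy _ (hc _ (Nat.lt_succ_self _))]

lemma step_congr {R R' : ℕ → Bool} {X : State} (h : ∀ k < useBound X.1.length, R k = R' k) :
    step R X = step R' X := by
  have : commits R X.1 = commits R' X.1 := by
    funext E
    exact decide_eq_decide.2 (commits_congr h E)
  simp only [step, this]

lemma computable_table {R : ℕ → Bool} (hR : Computable R) :
    Computable fun n => (List.range n).map R := by
  refine (Computable.nat_rec (f := fun n : ℕ => n) (g := fun _ => ([] : List Bool))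
    (h := fun _ q => q.2 ++ [R q.1]) Computable.id (Computable.const []) ?_).of_eq fun n => ?_
  · exact Computable.list_concat.comp (Computable.snd.comp Computable.snd)
      (hR.comp (Computable.fst.comp Computable.snd))
  · induction n with
    | zero => rfl
    | succ n ih => rw [List.range_succ, List.map_append, ← ih]; rfl

/-- Each step is primitive recursive in a finite table of values of R, and the table is computable
from the size of the tree. -/
lemma computable_stage {R : ℕ → Bool} (hR : Computable R) : Computable (stage R) := by
  refine (Computable.nat_rec (f := fun n : ℕ => n) (g := fun _ => (([0], 0, []) : State))
    (h := fun _ q => step (tableFun ((List.range (useBound q.2.1.length)).map R)) q.2)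
    Computable.id (Computable.const _) ?_).of_eq fun n => ?_
  · have hX : Computable fun q : ℕ × ℕ × State => q.2.2 := Computable.snd.comp Computable.snd
    have hn : Computable fun q : ℕ × ℕ × State => q.2.2.1.length :=
      Computable.list_length.comp (Computable.fst.comp hX)
    have hb : Primrec useBound :=
      Primrec.succ.comp (Primrec₂.natPair.comp Primrec.id
        (Primrec₂.natPair.comp Primrec.id Primrec.id))
    exact primrec₂_step.to_comp.comp ((computable_table hR).comp (hb.to_comp.comp hn)) hX
  · induction n with
    | zero => rfl
    | succ n ih =>
      refine Eq.trans ?_ (step_congr (R := tableFun ((List.range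
        (useBound (stage R n).1.length)).map R)) fun k hk => ?_)
      · simp only [ih]
      · rw [tableFun, List.getD_eq_getElem _ _ (by simpa using hk)]
        simp

lemma computablePred_le {R : ℕ → Bool} (hR : Computable R) :
    ComputablePred fun q : ℕ × ℕ => le (parent R) q.1 q.2 := by
  classical
  have h1 : Primrec fun q : List ℕ × ℕ × ℕ => decide (Reaches q.1 q.2.1 q.2.2) :=
    (primrecPred_reaches Primrec.fst (Primrec.fst.comp Primrec.snd)
      (Primrec.snd.comp Primrec.snd)).decide
  have h2 : Computable fun q : ℕ × ℕ => decide (Reaches (stage R q.1).1 q.1 q.2) :=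
    h1.to_comp.comp (Computable.pair (Computable.fst.comp ((computable_stage hR).comp Computable.fst))
      (Computable.pair Computable.fst Computable.snd))
  refine (Computable.computablePred h2).of_eq fun q => ?_
  exact (isParent_parent R).reaches_iff (agrees_stage R q.1) (lt_length_stage R q.1)

/-! ### The theorem -/

lemma _root_.IsPosetTree.of_relIso {P Q : Type} {r : P → P → Prop} {s : Q → Q → Prop}
    (h : IsPosetTree r) (f : r ≃r s) : IsPosetTree s := by
  obtain ⟨h1, h2, h3, ⟨t, ht⟩, h4⟩ := h
  have key : ∀ {x y}, s x y ↔ r (f.symm x) (f.symm y) := f.symm.map_rel_iff.symm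
  refine ⟨fun x => key.2 (h1 _), fun x y hxy hyx => f.symm.injective (h2 _ _ (key.1 hxy) (key.1 hyx)),
    fun x y z hxy hyz => key.2 (h3 _ _ _ (key.1 hxy) (key.1 hyz)),
    ⟨f t, fun x => key.2 (by rw [f.symm_apply_apply]; exact ht _)⟩, fun x => ⟨?_, fun y z hy hz => ?_⟩⟩
  · refine (((h4 (f.symm x)).1).image f).subset fun y hy => ⟨f.symm y, key.1 hy, f.apply_symm_apply y⟩
  · rw [key, key]
    exact (h4 (f.symm x)).2 _ _ (key.1 hy) (key.1 hz)

theorem exists_tree : ∃ le : ℕ → ℕ → Prop,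
    ComputablePred (fun p : ℕ × ℕ => le p.1 p.2) ∧
    IsPosetTree le ∧ IsUniquelyBranching le ∧ IsBinaryTree le ∧
    ∀ le' : ℕ → ℕ → Prop, PrimrecRel le' → IsPosetTree le' → IsEmpty (le ≃r le') := by
  obtain ⟨R, hR, huniv⟩ := exists_universal
  have hp := isParent_parent R
  have hc := isCovered_parent R
  refine ⟨le (parent R), computablePred_le hR, hp.isPosetTree, hc.isUniquelyBranching hp,
    hc.isBinaryTree hp, fun le' hle' htree => ⟨fun f => ?_⟩⟩
  obtain ⟨e, he⟩ := huniv le' hle'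
  obtain rfl : Rel R e = le' := funext₂ fun x y => propext (he x y)
  exact not_iso htree f

theorem not_punctuallyRobust : ¬ PunctuallyRobust (fun _ le => IsPosetTree le) := by
  obtain ⟨le, hcomp, htree, -, -, hle⟩ := exists_tree
  intro h
  let r : ↥(Set.univ : Set ℕ) → ↥(Set.univ : Set ℕ) → Prop := fun x y => le x.1 y.1
  let f : le ≃r r := ⟨(Equiv.Set.univ ℕ).symm, Iff.rfl⟩
  have hstr : IsComputableStructure Set.univ r := by
    refine ⟨Set.infinite_univ, ?_, ?_⟩
    · exact ((Computable.const true).computablePred (p := fun _ : ℕ => True)).of_eq fun x => by simp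
    · exact hcomp.of_eq fun q => by simp [r]
  obtain ⟨s, hs, ⟨g⟩⟩ := h Set.univ r hstr (htree.of_relIso f)
  exact (hle s hs (htree.of_relIso (f.trans g))).false (f.trans g)

end PosetTreeConstruction

theorem theorem2 :
    ¬ PunctuallyRobust (fun _ le => IsPosetTree le) ∧
    ∃ le : ℕ → ℕ → Prop,
      ComputablePred (fun p : ℕ × ℕ => le p.1 p.2) ∧
      IsPosetTree le ∧ IsUniquelyBranching le ∧ IsBinaryTree le ∧
      ∀ le' : ℕ → ℕ → Prop, PrimrecRel le' → IsPosetTree le' → IsEmpty (le ≃r le') :=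
  ⟨PosetTreeConstruction.not_punctuallyRobust, PosetTreeConstruction.exists_tree⟩
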